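/- For positive integers $s_1,\dots,s_r$ with $s_1\ge 2$ let $$\zeta^\star(s_1,\dots,s_r)=\sum_{k_1\ge\cdots\ge k_r\ge 1}\frac{1}{k_1^{s_1}\cdots k_r^{s_r}}$$ be the (convergent) multiple zeta star value. Write $\{2\}^a$ for $a$ successive repetitions of $2$, and let $B_m$ denote the Bernoulli numbers. For integers $d\ge 1$ and $n\ge 0$ put $$Z^\star(d,n)=\sum_{\substack{a_1+\cdots+a_{2d+1}=n\\ a_1,\dots,a_{2d+1}\ge 0}}\zeta^\star(\{2\}^{a_1},3,\{2\}^{a_2},1,\dots,3,\{2\}^{a_{2d}},1,\{2\}^{a_{2d+1}}),$$ $$Z^\star_0(d,n)=\sum_{\substack{a_1+\cdots+a_{2d}=n\\ a_1,\dots,a_{2d}\ge 0}}\zeta^\star(\{2\}^{a_1},3,\{2\}^{a_2},1,\dots,3,\{2\}^{a_{2d}},1),$$ and, for $n\ge 1$, $$Z^\star_1(d,n)=\sum_{\substack{a_1+\cdots+a_{2d+1}=n-1\\ a_1,\dots,a_{2d+1}\ge 0}}\zeta^\star(\{2\}^{a_1},3,\{2\}^{a_2},1,\dots,3,\{2\}^{a_{2d}},1,\{2\}^{a_{2d+1}+1}).$$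 Then, for any integers $d\ge 1$ and $n\ge 0$, all the series $\zeta^\star$ occurring in these sums converge, and $$Z^\star_0(d,n)=4\pi^{2n+4d}\sum_{k=0}^{n+2d}\sum_{r=0}^n(-1)^{n+k+r}(4^{k+1}-1)\binom{k}{r}\binom{n+2d-k}{n-r}\frac{B_{2k+2}}{(2k+2)!}\frac{B_{2n+4d-2k}}{(2n+4d-2k)!},$$ $$Z^\star(d,n)=4\pi^{2n+4d}\sum_{k=0}^{n+2d}\sum_{r=0}^n(-1)^{n+k+r}(4^{k+1}-1)\binom{k+1}{r}\binom{n+2d-k}{n-r}\frac{B_{2k+2}}{(2k+2)!}\frac{B_{2n+4d-2k}}{(2n+4d-2k)!},$$ and, for $n\ge 1$, $$Z^\star_1(d,n)=4\pi^{2n+4d}\sum_{k=0}^{n+2d}\sum_{r=0}^{n-1}(-1)^{n+k+r+1}(4^{k+1}-1)\binom{k}{r}\binom{n+2d-k}{n-1-r}\frac{B_{2k+2}}{(2k+2)!}\frac{B_{2n+4d-2k}}{(2n+4d-2k)!}.$$ -/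

import Mathlib

/-- The general term `1 / (k₁ ^ s₁ ⋯ k_r ^ s_r)` of the series `ζ⋆(s₁, …, s_r)`, indexed by the
tuples of integers `k₁ ≥ ⋯ ≥ k_r ≥ 1`. -/
noncomputable def zetaStarTerm (s : List ℕ)
    (k : {k : Fin s.length → ℕ // Antitone k ∧ ∀ i, 1 ≤ k i}) : ℝ :=
  1 / ∏ i, (k.1 i : ℝ) ^ s.get i

/-- The multiple zeta star value `ζ⋆(s₁, …, s_r)`. -/
noncomputable def zetaStar (s : List ℕ) : ℝ :=
  ∑' k, zetaStarTerm s k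

/-- The word `{2}^{a₁}, 3, {2}^{a₂}, 1, …, 3, {2}^{a_{2d}}, 1`
(with `a₁, …, a_{2d}` numbered from `0` to `2 * d - 1`). -/
def word321 (d : ℕ) (a : Fin (2 * d) → ℕ) : List ℕ :=
  (List.ofFn fun j : Fin d =>
    List.replicate (a ⟨2 * j, by omega⟩) 2 ++ [3] ++
      List.replicate (a ⟨2 * j + 1, by omega⟩) 2 ++ [1]).flatten

/-- `Z⋆(d, n)`, the sum of `ζ⋆({2}^{a₁}, 3, {2}^{a₂}, 1, …, 3, {2}^{a_{2d}}, 1, {2}^{a_{2d+1}})`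
over all `a₁ + ⋯ + a_{2d+1} = n`. -/
noncomputable def ZStar (d n : ℕ) : ℝ :=
  ∑ a ∈ Finset.Nat.antidiagonalTuple (2 * d + 1) n,
    zetaStar (word321 d (fun i => a i.castSucc) ++ List.replicate (a (Fin.last (2 * d))) 2)

/-- `Z⋆₀(d, n)`, the sum of `ζ⋆({2}^{a₁}, 3, {2}^{a₂}, 1, …, 3, {2}^{a_{2d}}, 1)`
over all `a₁ + ⋯ + a_{2d} = n`. -/
noncomputable def ZStar₀ (d n : ℕ) : ℝ :=
  ∑ a ∈ Finset.Nat.antidiagonalTuple (2 * d) n, zetaStar (word321 d a)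

/-- `Z⋆₁(d, n)`, the sum of
`ζ⋆({2}^{a₁}, 3, {2}^{a₂}, 1, …, 3, {2}^{a_{2d}}, 1, {2}^{a_{2d+1} + 1})`
over all `a₁ + ⋯ + a_{2d+1} = n - 1` (an empty sum for `n = 0`). -/
noncomputable def ZStar₁ (d : ℕ) : ℕ → ℝ
  | 0 => 0
  | m + 1 =>
    ∑ a ∈ Finset.Nat.antidiagonalTuple (2 * d + 1) m,
      zetaStar (word321 d (fun i => a i.castSucc) ++
        List.replicate (a (Fin.last (2 * d)) + 1) 2)

/-! Truncate every series at `k₁ ≤ N` and form the generating function with weight `x` for each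
letter 2 and `y` for each odd letter. Let `p N`, `q N` be its parts with an even, respectively odd,
number of odd letters. Splitting off `k₁ = N` gives a coupled linear recursion: `p N - p (N-1) =
x/N² (p N - κ) + y/N³ q N` and `q N - q (N-1) = x/N² q N + y/N p N`. Here `κ = 0` admits all words,
and `κ = 1` discards those ending in 2.

The recursion is solved in the basis `c(N,k) = N!²/((N-k)!(N+k)!)`. By `sq_sub_sq_mul_centralRatio`
the operator `N²Δ` is diagonal in this basis with eigenvalue `k²`, and by `centralRatio_abel` a
factor `N` is traded for a factor `k`. What remains is a pair of first-order recurrences in `k`,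
solved by the products `altProd` with `u = x + y`, `v = x - y`. As `N → ∞` all `c(N,k)` tend to 1,
so `p` tends to a combination of `ρ` and `1/ρ`, where `ρ = lim altProd`. Euler's sine product
evaluates `ρ` as `(tan α / α)(β cot β)` with `α = π√u/2`, `β = π√v/2`.

Put `x = λτ`, `y = λ`. The Bernoulli expansions of `tan` and `cot` make the limit a power series in
`λ`. Comparing coefficients of `λ`, and then of the resulting polynomials in `τ`, gives `Z⋆₀` and
`Z⋆`; Pascal's rule gives `Z⋆₁ = Z⋆ - Z⋆₀`. All terms are nonnegative, so boundedness of the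
generating function in `N` already yields convergence. -/

/-! ### Truncated multiple zeta star values -/

/-- The truncation `∑_{N ≥ k₁ ≥ ⋯ ≥ k_r ≥ 1} 1 / (k₁ ^ s₁ ⋯ k_r ^ s_r)` of `ζ⋆(s₁, …, s_r)`. -/
noncomputable def truncZetaStar : List ℕ → ℕ → ℝ
  | [], _ => 1
  | s :: l, N => ∑ k ∈ Finset.Icc 1 N, 1 / (k : ℝ) ^ s * truncZetaStar l k

theorem truncZetaStar_cons_zero (s : ℕ) (l : List ℕ) : truncZetaStar (s :: l) 0 = 0 := by
  simp [truncZetaStar]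

theorem truncZetaStar_cons_succ (s : ℕ) (l : List ℕ) (N : ℕ) :
    truncZetaStar (s :: l) (N + 1) =
      truncZetaStar (s :: l) N + 1 / ((N + 1 : ℕ) : ℝ) ^ s * truncZetaStar l (N + 1) := by
  simp only [truncZetaStar]
  rw [Finset.sum_Icc_succ_top (by omega)]

theorem truncZetaStar_nonneg (l : List ℕ) (N : ℕ) : 0 ≤ truncZetaStar l N := by
  induction l generalizing N with
  | nil => simp [truncZetaStar]
  | cons s l ih =>
    exact Finset.sum_nonneg fun k _ => mul_nonneg (by positivity) (ih k)

/-- The antitone `r`-tuples with entries in `[1, N]`. -/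
def antitoneBox (r N : ℕ) : Finset (Fin r → ℕ) :=
  open Classical in (Fintype.piFinset fun _ : Fin r => Finset.Icc 1 N).filter Antitone

theorem mem_antitoneBox {r N : ℕ} {k : Fin r → ℕ} :
    k ∈ antitoneBox r N ↔ (∀ i, 1 ≤ k i ∧ k i ≤ N) ∧ Antitone k := by
  simp [antitoneBox]

theorem Fin.antitone_cons_iff {r m : ℕ} {k : Fin r → ℕ} :
    Antitone (Fin.cons m k : Fin (r + 1) → ℕ) ↔ (∀ i, k i ≤ m) ∧ Antitone k := by
  constructor
  · intro h
    refine ⟨fun i => by simpa using h (Fin.zero_le i.succ), fun i j hij => ?_⟩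
    simpa using h (Fin.succ_le_succ_iff.2 hij)
  · rintro ⟨h1, h2⟩ i j hij
    induction i using Fin.cases with
    | zero =>
      induction j using Fin.cases with
      | zero => simp
      | succ j => simpa using h1 j
    | succ i =>
      induction j using Fin.cases with
      | zero => simp at hij
      | succ j => simpa using h2 (Fin.succ_le_succ_iff.1 hij)

theorem sum_antitoneBox_succ (r N : ℕ) (f : (Fin (r + 1) → ℕ) → ℝ) :
    ∑ k ∈ antitoneBox (r + 1) N, f k =
      ∑ m ∈ Finset.Icc 1 N, ∑ k ∈ antitoneBox r m, f (Fin.cons m k) := by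
  rw [Finset.sum_sigma']
  refine Finset.sum_bij' (fun k _ => ⟨k 0, Fin.tail k⟩) (fun p _ => Fin.cons p.1 p.2)
    ?_ ?_ ?_ ?_ ?_
  · intro k hk
    obtain ⟨m, k, rfl⟩ : ∃ m k', k = Fin.cons m k' := ⟨k 0, Fin.tail k, (Fin.cons_self_tail k).symm⟩
    rw [mem_antitoneBox, Fin.antitone_cons_iff] at hk
    have h0 := hk.1 0
    simp only [Fin.cons_zero] at h0
    simp only [Finset.mem_sigma, Finset.mem_Icc, Fin.cons_zero, Fin.tail_cons, mem_antitoneBox]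
    exact ⟨h0, fun i => ⟨by simpa using (hk.1 i.succ).1, hk.2.1 i⟩, hk.2.2⟩
  · rintro ⟨m, k⟩ hk
    simp only [Finset.mem_sigma, Finset.mem_Icc, mem_antitoneBox] at hk
    rw [mem_antitoneBox, Fin.antitone_cons_iff]
    refine ⟨fun i => ?_, fun i => (hk.2.1 i).2, hk.2.2⟩
    induction i using Fin.cases with
    | zero => simpa using hk.1
    | succ i => simpa using ⟨(hk.2.1 i).1, (hk.2.1 i).2.trans hk.1.2⟩
  · intro k _
    exact Fin.cons_self_tail k
  · rintro ⟨m, k⟩ _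
    simp
  · intro k _
    rw [Fin.cons_self_tail]

theorem sum_antitoneBox_eq_truncZetaStar (s : List ℕ) (N : ℕ) :
    ∑ k ∈ antitoneBox s.length N, 1 / ∏ i, (k i : ℝ) ^ s.get i = truncZetaStar s N := by
  induction s generalizing N with
  | nil =>
    have : antitoneBox ([] : List ℕ).length N = {fun i => i.elim0} := by
      ext k
      simp only [mem_antitoneBox, Finset.mem_singleton]
      exact ⟨fun _ => funext fun i => i.elim0, fun _ => ⟨fun i => i.elim0, fun i => i.elim0⟩⟩
    rw [this]
    simp [truncZetaStar]
  | cons s l ih =>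
    have h := sum_antitoneBox_succ l.length N
      fun k => 1 / ∏ i : Fin (l.length + 1), (k i : ℝ) ^ (s :: l).get i
    refine h.trans ?_
    refine Finset.sum_congr rfl fun m _ => ?_
    rw [← ih, Finset.mul_sum]
    refine Finset.sum_congr rfl fun k _ => ?_
    rw [Fin.prod_univ_succ]
    simp only [Fin.cons_zero, Fin.cons_succ, List.get_cons_zero, List.get_cons_succ']
    rw [one_div_mul_one_div]

/-- The indices of `zetaStarTerm s` with all entries at most `N`. -/
def zetaStarIndex (s : List ℕ) (N : ℕ) :
    Finset {k : Fin s.length → ℕ // Antitone k ∧ ∀ i, 1 ≤ k i} :=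
  open Classical in (antitoneBox s.length N).subtype _

theorem mem_zetaStarIndex {s : List ℕ} {N : ℕ}
    {k : {k : Fin s.length → ℕ // Antitone k ∧ ∀ i, 1 ≤ k i}} :
    k ∈ zetaStarIndex s N ↔ ∀ i, k.1 i ≤ N := by
  simp only [zetaStarIndex, Finset.mem_subtype, mem_antitoneBox]
  exact ⟨fun h i => (h.1 i).2, fun h => ⟨fun i => ⟨k.2.2 i, h i⟩, k.2.1⟩⟩

theorem sum_zetaStarIndex (s : List ℕ) (N : ℕ) :
    ∑ k ∈ zetaStarIndex s N, zetaStarTerm s k = truncZetaStar s N := by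
  classical
  rw [← sum_antitoneBox_eq_truncZetaStar, zetaStarIndex]
  exact Finset.sum_subtype_of_mem (fun k : Fin s.length → ℕ => 1 / ∏ i, (k i : ℝ) ^ s.get i)
    fun k hk => ⟨(mem_antitoneBox.1 hk).2, fun i => ((mem_antitoneBox.1 hk).1 i).1⟩

theorem zetaStarTerm_nonneg (s : List ℕ) (k) : 0 ≤ zetaStarTerm s k := by
  unfold zetaStarTerm
  positivity

theorem tendsto_zetaStarIndex (s : List ℕ) :
    Filter.Tendsto (zetaStarIndex s) Filter.atTop Filter.atTop := by
  refine Filter.tendsto_atTop_finset_of_monotone ?_ ?_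
  · intro M N hMN k hk
    rw [mem_zetaStarIndex] at hk ⊢
    exact fun i => (hk i).trans hMN
  · intro k
    refine ⟨∑ i, k.1 i, mem_zetaStarIndex.2 fun i => ?_⟩
    exact Finset.single_le_sum (f := k.1) (fun _ _ => Nat.zero_le _) (Finset.mem_univ i)

theorem summable_zetaStarTerm_of_bounded {s : List ℕ} {c : ℝ}
    (h : ∀ N, truncZetaStar s N ≤ c) : Summable (zetaStarTerm s) := by
  refine summable_of_sum_le (c := c) (zetaStarTerm_nonneg s) fun u => ?_
  obtain ⟨N, hN⟩ := ((tendsto_zetaStarIndex s).eventually_ge_atTop u).exists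
  calc ∑ k ∈ u, zetaStarTerm s k ≤ ∑ k ∈ zetaStarIndex s N, zetaStarTerm s k :=
        Finset.sum_le_sum_of_subset_of_nonneg hN fun k _ _ => zetaStarTerm_nonneg s k
    _ = truncZetaStar s N := sum_zetaStarIndex s N
    _ ≤ c := h N

theorem tendsto_truncZetaStar {s : List ℕ} (h : Summable (zetaStarTerm s)) :
    Filter.Tendsto (truncZetaStar s) Filter.atTop (nhds (zetaStar s)) := by
  have := h.hasSum.comp (tendsto_zetaStarIndex s)
  refine this.congr fun N => ?_
  exact sum_zetaStarIndex s N

/-! ### Sums over words in 3, 2, 1 -/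

theorem Finset.Nat.sum_antidiagonalTuple_succ {M : Type*} [AddCommMonoid M] (r n : ℕ)
    (f : (Fin (r + 1) → ℕ) → M) :
    ∑ a ∈ Finset.Nat.antidiagonalTuple (r + 1) n, f a =
      ∑ p ∈ Finset.HasAntidiagonal.antidiagonal n,
        ∑ a ∈ Finset.Nat.antidiagonalTuple r p.2, f (Fin.cons p.1 a) := by
  rw [Finset.sum_sigma']
  refine Finset.sum_bij' (fun a _ => ⟨(a 0, ∑ i, Fin.tail a i), Fin.tail a⟩)
    (fun p _ => Fin.cons p.1.1 p.2) ?_ ?_ ?_ ?_ ?_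
  · intro a ha
    rw [Finset.Nat.mem_antidiagonalTuple, Fin.sum_univ_succ] at ha
    simp only [Finset.mem_sigma, Finset.HasAntidiagonal.mem_antidiagonal,
      Finset.Nat.mem_antidiagonalTuple, and_true]
    exact ha
  · rintro ⟨⟨i, j⟩, a⟩ ha
    simp only [Finset.mem_sigma, Finset.HasAntidiagonal.mem_antidiagonal,
      Finset.Nat.mem_antidiagonalTuple] at ha
    rw [Finset.Nat.mem_antidiagonalTuple, Fin.sum_univ_succ]
    simp [ha.2, ha.1]
  · intro a _
    exact Fin.cons_self_tail a
  · rintro ⟨⟨i, j⟩, a⟩ ha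
    simp only [Finset.mem_sigma, Finset.HasAntidiagonal.mem_antidiagonal,
      Finset.Nat.mem_antidiagonalTuple] at ha
    obtain ⟨h1, rfl⟩ := ha
    simp
  · intro a _
    rw [Fin.cons_self_tail]

/-- The odd letter at the head of an alternating word in `3`, `1` with `m` odd letters, ending in
`1`. -/
def oddLetter (m : ℕ) : ℕ := if Even m then 3 else 1

/-- The sum of `φ` over the words with `m` odd letters (alternating, the last one being `1`) and
`n` letters `2`, where the words that end in `2` are weighted by `1 - κ`. -/
noncomputable def wordSum (κ : ℝ) : ℕ → ℕ → (List ℕ → ℝ) → ℝ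
  | 0, n, φ => if n = 0 then φ [] else (1 - κ) * φ (List.replicate n 2)
  | m + 1, n, φ => ∑ p ∈ Finset.HasAntidiagonal.antidiagonal n,
      wordSum κ m p.2 fun l => φ (List.replicate p.1 2 ++ oddLetter (m + 1) :: l)

section wordSum

variable (κ : ℝ)

theorem wordSum_succ_zero (m : ℕ) (φ : List ℕ → ℝ) :
    wordSum κ (m + 1) 0 φ = wordSum κ m 0 fun l => φ (oddLetter (m + 1) :: l) := by
  simp [wordSum]

theorem wordSum_succ_succ (m n : ℕ) (φ : List ℕ → ℝ) :
    wordSum κ (m + 1) (n + 1) φ = wordSum κ m (n + 1) (fun l => φ (oddLetter (m + 1) :: l)) +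
      wordSum κ (m + 1) n fun l => φ (2 :: l) := by
  simp only [wordSum]
  rw [Finset.Nat.sum_antidiagonal_succ]
  simp [List.replicate_succ]

theorem wordSum_add (m n : ℕ) (φ ψ : List ℕ → ℝ) :
    wordSum κ m n (fun l => φ l + ψ l) = wordSum κ m n φ + wordSum κ m n ψ := by
  induction m generalizing n φ ψ with
  | zero =>
    simp only [wordSum]
    split_ifs <;> ring
  | succ m ih => simp only [wordSum, ih, Finset.sum_add_distrib]

theorem wordSum_const_mul (m n : ℕ) (c : ℝ) (φ : List ℕ → ℝ) :
    wordSum κ m n (fun l => c * φ l) = c * wordSum κ m n φ := by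
  induction m generalizing n φ with
  | zero =>
    simp only [wordSum]
    split_ifs <;> ring
  | succ m ih => simp only [wordSum, ih, Finset.mul_sum]

variable {κ} in
theorem wordSum_mono (hκ : κ ≤ 1) (m n : ℕ) {φ ψ : List ℕ → ℝ} (h : ∀ l, φ l ≤ ψ l) :
    wordSum κ m n φ ≤ wordSum κ m n ψ := by
  induction m generalizing n φ ψ with
  | zero =>
    simp only [wordSum]
    split_ifs
    · exact h _
    · exact mul_le_mul_of_nonneg_left (h _) (by linarith)
  | succ m ih => exact Finset.sum_le_sum fun p _ => ih _ fun l => h _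

theorem wordSum_zero_fun (m n : ℕ) : wordSum κ m n (fun _ => 0) = 0 := by
  simpa using wordSum_const_mul κ m n 0 fun _ => 0

end wordSum

theorem word321_zero (a : Fin (2 * 0) → ℕ) : word321 0 a = [] := by
  simp [word321]

theorem word321_succ (d i j : ℕ) (a : Fin (2 * d) → ℕ) :
    word321 (d + 1) (Fin.cons i (Fin.cons j a : Fin (2 * d + 1) → ℕ) : Fin (2 * d + 1 + 1) → ℕ) =
      List.replicate i 2 ++ 3 :: (List.replicate j 2 ++ 1 :: word321 d a) := by
  simp only [word321, List.ofFn_succ, List.flatten_cons]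
  have h0 : (Fin.cons i (Fin.cons j a : Fin (2 * d + 1) → ℕ) : Fin (2 * d + 1 + 1) → ℕ)
      ⟨2 * ((0 : Fin (d + 1)) : ℕ), by simp⟩ = i := rfl
  have h1 : (Fin.cons i (Fin.cons j a : Fin (2 * d + 1) → ℕ) : Fin (2 * d + 1 + 1) → ℕ)
      ⟨2 * ((0 : Fin (d + 1)) : ℕ) + 1, by simp⟩ = j := rfl
  rw [h0, h1]
  simp only [List.append_assoc, List.cons_append, List.nil_append]
  congr 5

theorem oddLetter_two_mul (d : ℕ) : oddLetter (2 * d + 1 + 1) = 3 := by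
  rw [oddLetter, if_pos (by simp [parity_simps])]

theorem oddLetter_two_mul_add_one (d : ℕ) : oddLetter (2 * d + 1) = 1 := by
  rw [oddLetter, if_neg (by simp [parity_simps])]

theorem wordSum_two_mul_add_two (κ : ℝ) (d n : ℕ) (φ : List ℕ → ℝ) :
    wordSum κ (2 * (d + 1)) n φ = ∑ p ∈ Finset.HasAntidiagonal.antidiagonal n,
      ∑ q ∈ Finset.HasAntidiagonal.antidiagonal p.2,
      wordSum κ (2 * d) q.2 fun l =>
        φ (List.replicate p.1 2 ++ 3 :: (List.replicate q.1 2 ++ 1 :: l)) := by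
  change wordSum κ (2 * d + 1 + 1) n φ = _
  simp only [wordSum, oddLetter_two_mul, oddLetter_two_mul_add_one]

/-- For `κ = 1` a nonempty trailing block of 2's has weight 0, so exactly the words without such a
block survive. -/
theorem sum_word321 (d n : ℕ) (φ : List ℕ → ℝ) :
    ∑ a ∈ Finset.Nat.antidiagonalTuple (2 * d) n, φ (word321 d a) = wordSum 1 (2 * d) n φ := by
  induction d generalizing n φ with
  | zero =>
    cases n with
    | zero => simp [wordSum, word321_zero]
    | succ n => simp [wordSum]
  | succ d ih =>
    rw [wordSum_two_mul_add_two]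
    refine (Finset.Nat.sum_antidiagonalTuple_succ (2 * d + 1) n _).trans ?_
    refine Finset.sum_congr rfl fun p _ => ?_
    rw [Finset.Nat.sum_antidiagonalTuple_succ (2 * d)]
    refine Finset.sum_congr rfl fun q _ => ?_
    rw [← ih]
    refine Finset.sum_congr rfl fun a _ => ?_
    rw [word321_succ]

theorem sum_word321_append (d n : ℕ) (φ : List ℕ → ℝ) :
    ∑ a ∈ Finset.Nat.antidiagonalTuple (2 * d + 1) n,
      φ (word321 d (fun i => a i.castSucc) ++ List.replicate (a (Fin.last (2 * d))) 2) =
        wordSum 0 (2 * d) n φ := by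
  induction d generalizing n φ with
  | zero =>
    refine (congrArg (fun s => Finset.sum s _) (Finset.Nat.antidiagonalTuple_one n)).trans ?_
    rw [Finset.sum_singleton, word321_zero]
    cases n with
    | zero => simp [wordSum]
    | succ n => simp [wordSum]
  | succ d ih =>
    rw [wordSum_two_mul_add_two]
    refine (Finset.Nat.sum_antidiagonalTuple_succ (2 * d + 2) n _).trans ?_
    refine Finset.sum_congr rfl fun p _ => ?_
    rw [Finset.Nat.sum_antidiagonalTuple_succ (2 * d + 1)]
    refine Finset.sum_congr rfl fun q _ => ?_
    rw [← ih]
    refine Finset.sum_congr rfl fun a _ => ?_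
    have h := word321_succ d p.1 q.1 fun i => a i.castSucc
    have h' : (fun i : Fin (2 * (d + 1)) =>
        (Fin.cons p.1 (Fin.cons q.1 a : Fin (2 * d + 2) → ℕ) : Fin (2 * d + 3) → ℕ) i.castSucc) =
        (Fin.cons p.1 (Fin.cons q.1 (fun i => a i.castSucc) : Fin (2 * d + 1) → ℕ) :
          Fin (2 * d + 1 + 1) → ℕ) := by
      funext i
      revert i
      change ∀ i : Fin (2 * d + 1 + 1), _
      intro i
      induction i using Fin.cases with
      | zero => rfl
      | succ i =>
        induction i using Fin.cases with
        | zero => rfl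
        | succ i => rfl
    rw [h', h]
    simp only [List.append_assoc, List.cons_append]
    rfl

/-- Used for convergence: a bound on the whole sum of nonnegative terms bounds each single word. -/
theorem le_wordSum (d b : ℕ) (a : Fin (2 * d) → ℕ) {φ : List ℕ → ℝ} (hφ : ∀ l, 0 ≤ φ l) :
    φ (word321 d a ++ List.replicate b 2) ≤ wordSum 0 (2 * d) (∑ i, a i + b) φ := by
  rw [← sum_word321_append]
  have h := Finset.single_le_sum (f := fun a' : Fin (2 * d + 1) → ℕ =>
      φ (word321 d (fun i => a' i.castSucc) ++ List.replicate (a' (Fin.last (2 * d))) 2))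
    (s := Finset.Nat.antidiagonalTuple (2 * d + 1) (∑ i, a i + b)) (fun _ _ => hφ _)
    (a := Fin.snoc a b) (by simp [Finset.Nat.mem_antidiagonalTuple, Fin.sum_univ_castSucc])
  simpa using h

theorem wordSum_zero_eq_wordSum_one (m : ℕ) (φ : List ℕ → ℝ) :
    wordSum 0 m 0 φ = wordSum 1 m 0 φ := by
  induction m generalizing φ with
  | zero => simp [wordSum]
  | succ m ih => simp only [wordSum_succ_zero, ih]

/-- A word either has no trailing 2, or arises from a word with one 2 fewer by appending a 2. -/
theorem wordSum_zero_eq_wordSum_one_add (m n : ℕ) (φ : List ℕ → ℝ) :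
    wordSum 0 m (n + 1) φ = wordSum 1 m (n + 1) φ + wordSum 0 m n fun l => φ (l ++ [2]) := by
  induction m generalizing n φ with
  | zero =>
    cases n with
    | zero => simp [wordSum]
    | succ n => simp [wordSum, List.replicate_succ' (n := n + 1)]
  | succ m ih =>
    simp only [wordSum]
    rw [Finset.Nat.sum_antidiagonal_succ', Finset.Nat.sum_antidiagonal_succ']
    simp only [ih, Finset.sum_add_distrib, wordSum_zero_eq_wordSum_one, List.append_assoc,
      List.cons_append]
    ring

theorem ZStar_eq_add (d n : ℕ) : ZStar d n = ZStar₀ d n + ZStar₁ d n := by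
  rw [ZStar, ZStar₀, sum_word321, sum_word321_append]
  cases n with
  | zero => rw [ZStar₁, wordSum_zero_eq_wordSum_one, add_zero]
  | succ n =>
    rw [wordSum_zero_eq_wordSum_one_add, ZStar₁, ← sum_word321_append]
    simp only [List.replicate_succ', List.append_assoc]

/-! ### Recursion in the truncation bound -/

/-- The sum of the truncated star values over the words with `m` odd letters and `n` letters `2`. -/
noncomputable def truncSum (κ : ℝ) (N m n : ℕ) : ℝ :=
  wordSum κ m n fun l => truncZetaStar l N

section truncSum

variable (κ : ℝ)

theorem truncSum_zero_zero (N : ℕ) : truncSum κ N 0 0 = 1 := by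
  simp [truncSum, wordSum, truncZetaStar]

theorem truncSum_zero (m n : ℕ) (h : (m, n) ≠ (0, 0)) : truncSum κ 0 m n = 0 := by
  unfold truncSum
  induction m generalizing n with
  | zero =>
    cases n with
    | zero => simp at h
    | succ n => simp [wordSum, List.replicate_succ, truncZetaStar_cons_zero]
  | succ m ih =>
    induction n with
    | zero => simp only [wordSum_succ_zero, truncZetaStar_cons_zero, wordSum_zero_fun]
    | succ n ihn =>
      simp only [wordSum_succ_succ, truncZetaStar_cons_zero, wordSum_zero_fun, add_zero]

theorem truncSum_zero_succ (N n : ℕ) :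
    truncSum κ (N + 1) 0 (n + 1) = truncSum κ N 0 (n + 1) +
      1 / ((N + 1 : ℕ) : ℝ) ^ 2 * (truncSum κ (N + 1) 0 n - if n = 0 then κ else 0) := by
  cases n with
  | zero =>
    simp only [truncSum, wordSum, List.replicate_succ, truncZetaStar_cons_succ]
    simp [truncZetaStar]
    ring
  | succ n =>
    simp only [truncSum, wordSum, List.replicate_succ, truncZetaStar_cons_succ 2 (2 :: _)]
    simp
    ring

theorem truncSum_succ_zero (N m : ℕ) :
    truncSum κ (N + 1) (m + 1) 0 = truncSum κ N (m + 1) 0 +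
      1 / ((N + 1 : ℕ) : ℝ) ^ oddLetter (m + 1) * truncSum κ (N + 1) m 0 := by
  simp only [truncSum, wordSum_succ_zero, truncZetaStar_cons_succ, wordSum_add, wordSum_const_mul]

theorem truncSum_succ_succ (N m n : ℕ) :
    truncSum κ (N + 1) (m + 1) (n + 1) = truncSum κ N (m + 1) (n + 1) +
      1 / ((N + 1 : ℕ) : ℝ) ^ 2 * truncSum κ (N + 1) (m + 1) n +
      1 / ((N + 1 : ℕ) : ℝ) ^ oddLetter (m + 1) * truncSum κ (N + 1) m (n + 1) := by
  simp only [truncSum, wordSum_succ_succ, truncZetaStar_cons_succ, wordSum_add, wordSum_const_mul]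
  ring

variable {κ}

theorem truncSum_nonneg (hκ : κ ≤ 1) (N m n : ℕ) : 0 ≤ truncSum κ N m n := by
  rw [← wordSum_zero_fun κ m n]
  exact wordSum_mono hκ m n fun l => truncZetaStar_nonneg l N

end truncSum

/-- Either `k₁ ≤ N`, or `k₁ = N + 1` and the first letter can be stripped. The correction `κ` occurs
only for the word `[2]`: it has weight `1 - κ`, while the empty word left after stripping has weight
1. -/
theorem truncSum_rec (κ : ℝ) (N m n : ℕ) (h : m + n ≠ 0) :
    truncSum κ (N + 1) m n = truncSum κ N m n +
      (if n = 0 then 0 else 1 / ((N + 1 : ℕ) : ℝ) ^ 2 *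
        (truncSum κ (N + 1) m (n - 1) - if m + (n - 1) = 0 then κ else 0)) +
      (if m = 0 then 0 else
        1 / ((N + 1 : ℕ) : ℝ) ^ oddLetter m * truncSum κ (N + 1) (m - 1) n) := by
  cases m with
  | zero =>
    cases n with
    | zero => simp at h
    | succ n => simp [truncSum_zero_succ]
  | succ m =>
    cases n with
    | zero => simp [truncSum_succ_zero]
    | succ n => simp [truncSum_succ_succ]

/-- The homogeneous part of degree `w` of the generating function of `truncSum`, where the words
with `m` odd letters are weighted by `ε m`. -/
noncomputable def gradedSum (κ τ : ℝ) (ε : ℕ → ℝ) (N w : ℕ) : ℝ :=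
  ∑ p ∈ Finset.HasAntidiagonal.antidiagonal w, τ ^ p.1 * ε p.2 * truncSum κ N p.2 p.1

theorem gradedSum_zero_right (κ τ : ℝ) (ε : ℕ → ℝ) (N : ℕ) : gradedSum κ τ ε N 0 = ε 0 := by
  simp [gradedSum, truncSum_zero_zero]

theorem gradedSum_zero_left (κ τ : ℝ) (ε : ℕ → ℝ) (w : ℕ) : gradedSum κ τ ε 0 (w + 1) = 0 := by
  refine Finset.sum_eq_zero fun p hp => ?_
  rw [Finset.HasAntidiagonal.mem_antidiagonal] at hp
  rw [truncSum_zero, mul_zero]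
  intro h
  simp only [Prod.mk.injEq] at h
  omega

theorem gradedSum_nonneg {κ τ : ℝ} (hκ : κ ≤ 1) (hτ : 0 ≤ τ) {ε : ℕ → ℝ} (hε : ∀ m, 0 ≤ ε m)
    (N w : ℕ) : 0 ≤ gradedSum κ τ ε N w :=
  Finset.sum_nonneg fun _ _ =>
    mul_nonneg (mul_nonneg (pow_nonneg hτ _) (hε _)) (truncSum_nonneg hκ _ _ _)

theorem gradedSum_rec (κ τ : ℝ) (ε : ℕ → ℝ) (N w : ℕ) :
    gradedSum κ τ ε (N + 1) (w + 1) = gradedSum κ τ ε N (w + 1) +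
      τ / ((N + 1 : ℕ) : ℝ) ^ 2 *
        (gradedSum κ τ ε (N + 1) w - if w = 0 then κ * ε 0 else 0) +
      gradedSum κ τ (fun m => ε (m + 1) / ((N + 1 : ℕ) : ℝ) ^ oddLetter (m + 1)) (N + 1) w := by
  have h1 : gradedSum κ τ ε (N + 1) (w + 1) =
      gradedSum κ τ ε N (w + 1) +
      ∑ p ∈ Finset.HasAntidiagonal.antidiagonal (w + 1),
        τ ^ p.1 * ε p.2 * (if p.1 = 0 then 0 else 1 / ((N + 1 : ℕ) : ℝ) ^ 2 *
        (truncSum κ (N + 1) p.2 (p.1 - 1) - if p.2 + (p.1 - 1) = 0 then κ else 0)) +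
      ∑ p ∈ Finset.HasAntidiagonal.antidiagonal (w + 1),
        τ ^ p.1 * ε p.2 * (if p.2 = 0 then 0 else
        1 / ((N + 1 : ℕ) : ℝ) ^ oddLetter p.2 * truncSum κ (N + 1) (p.2 - 1) p.1) := by
    rw [gradedSum, gradedSum, ← Finset.sum_add_distrib, ← Finset.sum_add_distrib]
    refine Finset.sum_congr rfl fun p hp => ?_
    rw [Finset.HasAntidiagonal.mem_antidiagonal] at hp
    rw [truncSum_rec κ N p.2 p.1 (by omega)]
    ring
  rw [h1, Finset.Nat.sum_antidiagonal_succ, Finset.Nat.sum_antidiagonal_succ']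
  congr 1
  · congr 1
    simp only [if_true, mul_zero, zero_add, Nat.add_eq_zero_iff, one_ne_zero, and_false, if_false,
      Nat.add_sub_cancel]
    have h2 : (if w = 0 then κ * ε 0 else 0) = ∑ p ∈ Finset.HasAntidiagonal.antidiagonal w,
        τ ^ p.1 * ε p.2 * (if p.2 + p.1 = 0 then κ else 0) := by
      by_cases hw : w = 0
      · subst hw
        simp [mul_comm]
      · rw [if_neg hw]
        refine (Finset.sum_eq_zero fun p hp => ?_).symm
        rw [Finset.HasAntidiagonal.mem_antidiagonal] at hp
        rw [if_neg (by omega), mul_zero]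
    rw [h2, gradedSum, ← Finset.sum_sub_distrib, Finset.mul_sum]
    refine Finset.sum_congr rfl fun p _ => ?_
    simp only [Nat.add_eq_zero_iff]
    ring
  · simp only [if_true, mul_zero, Nat.add_eq_zero_iff, one_ne_zero, and_false, if_false,
      Nat.add_sub_cancel, zero_add]
    rw [gradedSum]
    refine Finset.sum_congr rfl fun p _ => ?_
    ring

/-- The indicator function of the even numbers. -/
noncomputable def evenInd (m : ℕ) : ℝ := if Even m then 1 else 0

/-- The indicator function of the odd numbers. -/
noncomputable def oddInd (m : ℕ) : ℝ := if Even m then 0 else 1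

theorem evenInd_nonneg (m : ℕ) : 0 ≤ evenInd m := by
  unfold evenInd
  split_ifs <;> norm_num

theorem oddInd_nonneg (m : ℕ) : 0 ≤ oddInd m := by
  unfold oddInd
  split_ifs <;> norm_num

theorem gradedSum_const_mul (κ τ c : ℝ) (ε : ℕ → ℝ) (N w : ℕ) :
    gradedSum κ τ (fun m => c * ε m) N w = c * gradedSum κ τ ε N w := by
  simp only [gradedSum, Finset.mul_sum]
  refine Finset.sum_congr rfl fun p _ => ?_
  ring

theorem gradedSum_evenInd_rec (κ τ : ℝ) (N w : ℕ) :
    gradedSum κ τ evenInd (N + 1) (w + 1) = gradedSum κ τ evenInd N (w + 1) +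
      τ / ((N + 1 : ℕ) : ℝ) ^ 2 * (gradedSum κ τ evenInd (N + 1) w - if w = 0 then κ else 0) +
      1 / ((N + 1 : ℕ) : ℝ) ^ 3 * gradedSum κ τ oddInd (N + 1) w := by
  rw [gradedSum_rec, ← gradedSum_const_mul]
  have h0 : evenInd 0 = 1 := by simp [evenInd]
  rw [h0, mul_one]
  congr 2
  funext m
  by_cases h : Even m <;> simp [evenInd, oddInd, oddLetter, h, parity_simps]

theorem gradedSum_oddInd_rec (κ τ : ℝ) (N w : ℕ) :
    gradedSum κ τ oddInd (N + 1) (w + 1) = gradedSum κ τ oddInd N (w + 1) +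
      τ / ((N + 1 : ℕ) : ℝ) ^ 2 * gradedSum κ τ oddInd (N + 1) w +
      1 / ((N + 1 : ℕ) : ℝ) * gradedSum κ τ evenInd (N + 1) w := by
  rw [gradedSum_rec, ← gradedSum_const_mul κ τ (1 / ((N + 1 : ℕ) : ℝ))]
  have h0 : oddInd 0 = 0 := by simp [oddInd]
  rw [h0, mul_zero, ite_self, sub_zero]
  congr 2
  funext m
  by_cases h : Even m <;> simp [evenInd, oddInd, oddLetter, h, parity_simps]

/-! ### The coupled recursion determines the generating functions -/

/-- The partial sums `A`, `B` are combined as `A + B / M`, the weight that balances the couplings `y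
/ M ^ 3` and `y / M`. One more term turns a bound `K` into `p + q + (x + y) * K`, so the fixed point
of this map bounds all partial sums. -/
theorem summable_of_coupled_rec {a b a' b' : ℕ → ℝ} {p q x y κ M : ℝ} (hM : 1 ≤ M)
    (hx : 0 ≤ x) (hy : 0 ≤ y) (hxy : x + y < 1) (hκ : 0 ≤ κ)
    (ha : ∀ w, 0 ≤ a w) (hb : ∀ w, 0 ≤ b w) (ha' : ∀ w, 0 ≤ a' w) (hb' : ∀ w, 0 ≤ b' w)
    (hp : HasSum a' p) (hq : HasSum b' q) (ha0 : a 0 = a' 0) (hb0 : b 0 = b' 0)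
    (har : ∀ w, a (w + 1) = a' (w + 1) + x / M ^ 2 * (a w - if w = 0 then κ else 0) +
      y / M ^ 3 * b w)
    (hbr : ∀ w, b (w + 1) = b' (w + 1) + x / M ^ 2 * b w + y / M * a w) :
    Summable a ∧ Summable b := by
  have hM0 : 0 < M := by linarith
  have hp0 : 0 ≤ p := hp.nonneg ha'
  have hq0 : 0 ≤ q := hq.nonneg hb'
  set K := (p + q) / (1 - (x + y)) with hK
  have hKeq : p + q + (x + y) * K = K := by
    rw [hK]
    field_simp [show (1 - (x + y)) ≠ 0 by linarith]
    ring
  have hK0 : 0 ≤ K := div_nonneg (by linarith) (by linarith)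
  have hA : ∀ W, ∑ w ∈ Finset.range (W + 1), a w ≤ p + x / M ^ 2 * ∑ w ∈ Finset.range W, a w +
      y / M ^ 3 * ∑ w ∈ Finset.range W, b w := by
    intro W
    have h1 : ∑ w ∈ Finset.range (W + 1), a' w ≤ p := sum_le_hasSum _ (fun w _ => ha' w) hp
    rw [Finset.sum_range_succ'] at h1 ⊢
    rw [Finset.mul_sum, Finset.mul_sum, ha0]
    have h2 : ∑ w ∈ Finset.range W, a (w + 1) ≤ ∑ w ∈ Finset.range W, a' (w + 1) +
        ∑ w ∈ Finset.range W, x / M ^ 2 * a w + ∑ w ∈ Finset.range W, y / M ^ 3 * b w := by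
      rw [← Finset.sum_add_distrib, ← Finset.sum_add_distrib]
      refine Finset.sum_le_sum fun w _ => ?_
      rw [har]
      have : 0 ≤ x / M ^ 2 := by positivity
      have : x / M ^ 2 * (a w - if w = 0 then κ else 0) ≤ x / M ^ 2 * a w := by
        refine mul_le_mul_of_nonneg_left ?_ this
        split_ifs <;> linarith
      linarith
    linarith
  have hB : ∀ W, ∑ w ∈ Finset.range (W + 1), b w ≤ q + x / M ^ 2 * ∑ w ∈ Finset.range W, b w +
      y / M * ∑ w ∈ Finset.range W, a w := by
    intro W
    have h1 : ∑ w ∈ Finset.range (W + 1), b' w ≤ q := sum_le_hasSum _ (fun w _ => hb' w) hq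
    rw [Finset.sum_range_succ'] at h1 ⊢
    rw [Finset.mul_sum, Finset.mul_sum, hb0]
    have h2 : ∑ w ∈ Finset.range W, b (w + 1) = ∑ w ∈ Finset.range W, b' (w + 1) +
        ∑ w ∈ Finset.range W, x / M ^ 2 * b w + ∑ w ∈ Finset.range W, y / M * a w := by
      rw [← Finset.sum_add_distrib, ← Finset.sum_add_distrib]
      exact Finset.sum_congr rfl fun w _ => hbr w
    linarith
  have hAB : ∀ W, ∑ w ∈ Finset.range W, a w + (∑ w ∈ Finset.range W, b w) / M ≤ K := by
    intro W
    induction W with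
    | zero => simpa using hK0
    | succ W ih =>
      have hA' := hA W
      have hB' := div_le_div_of_nonneg_right (hB W) hM0.le
      set A := ∑ w ∈ Finset.range W, a w
      set B := ∑ w ∈ Finset.range W, b w
      have hAn : 0 ≤ A := Finset.sum_nonneg fun w _ => ha w
      have hBn : 0 ≤ B := Finset.sum_nonneg fun w _ => hb w
      have e : x / M ^ 2 * A + y / M ^ 3 * B + (x / M ^ 2 * B + y / M * A) / M =
          (x + y) / M ^ 2 * (A + B / M) := by
        field_simp
        ring
      have h3 : (x + y) / M ^ 2 * (A + B / M) ≤ (x + y) * K := by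
        refine mul_le_mul ?_ ih (by positivity) (by linarith)
        exact div_le_self (by linarith) (one_le_pow₀ hM)
      have h4 : q / M ≤ q := div_le_self hq0 hM
      have h5 : (q + x / M ^ 2 * B + y / M * A) / M =
          q / M + (x / M ^ 2 * B + y / M * A) / M := by ring
      linarith
  refine ⟨summable_of_sum_range_le (c := K) ha fun W => ?_,
    summable_of_sum_range_le (c := K * M) hb fun W => ?_⟩
  · have : 0 ≤ (∑ w ∈ Finset.range W, b w) / M :=
      div_nonneg (Finset.sum_nonneg fun w _ => hb w) hM0.le
    linarith [hAB W]
  · have : 0 ≤ ∑ w ∈ Finset.range W, a w := Finset.sum_nonneg fun w _ => ha w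
    rw [← div_le_iff₀ hM0]
    linarith [hAB W]

theorem tsum_of_coupled_rec {a b a' b' : ℕ → ℝ} {p q x y κ M : ℝ}
    (hp : HasSum a' p) (hq : HasSum b' q) (ha0 : a 0 = a' 0) (hb0 : b 0 = b' 0)
    (har : ∀ w, a (w + 1) = a' (w + 1) + x / M ^ 2 * (a w - if w = 0 then κ else 0) +
      y / M ^ 3 * b w)
    (hbr : ∀ w, b (w + 1) = b' (w + 1) + x / M ^ 2 * b w + y / M * a w)
    (ha : Summable a) (hb : Summable b) :
    ∑' w, a w = p + x / M ^ 2 * (∑' w, a w - κ) + y / M ^ 3 * ∑' w, b w ∧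
    ∑' w, b w = q + x / M ^ 2 * ∑' w, b w + y / M * ∑' w, a w := by
  have hδ : HasSum (fun w : ℕ => if w = 0 then κ else 0) κ := by
    simpa using hasSum_ite_eq (0 : ℕ) κ
  have hp' : HasSum (fun w => a' (w + 1)) (p - a' 0) := by
    simpa using (hasSum_nat_add_iff' 1).2 hp
  have hq' : HasSum (fun w => b' (w + 1)) (q - b' 0) := by
    simpa using (hasSum_nat_add_iff' 1).2 hq
  constructor
  · have h := ((hp'.add ((ha.hasSum.sub hδ).mul_left (x / M ^ 2))).add
      (hb.hasSum.mul_left (y / M ^ 3))).tsum_eq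
    have h1 := ha.tsum_eq_zero_add
    simp only [har, ha0] at h1
    rw [h] at h1
    linarith
  · have h := ((hq'.add (hb.hasSum.mul_left (x / M ^ 2))).add
      (ha.hasSum.mul_left (y / M))).tsum_eq
    have h1 := hb.tsum_eq_zero_add
    simp only [hbr, hb0] at h1
    rw [h] at h1
    linarith

/-- The combinations `M * δp ± δq` diagonalise the system, with factors `M ^ 2 - (x ± y)` that are
positive because `x + y < 1 ≤ M ^ 2`. -/
theorem coupled_linear_unique {x y M δp δq : ℝ} (hM : 1 ≤ M) (hy : 0 ≤ y)
    (hxy : x + y < 1) (h1 : δp = x / M ^ 2 * δp + y / M ^ 3 * δq)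
    (h2 : δq = x / M ^ 2 * δq + y / M * δp) : δp = 0 ∧ δq = 0 := by
  have hM0 : 0 < M := by linarith
  have hM2 : 1 ≤ M ^ 2 := one_le_pow₀ hM
  field_simp at h1 h2
  have e1 : (M ^ 2 - (x + y)) * (M * δp + δq) = 0 := by linear_combination h1 + h2
  have e2 : (M ^ 2 - (x - y)) * (M * δp - δq) = 0 := by linear_combination h1 - h2
  have f1 : M * δp + δq = 0 := (mul_eq_zero.1 e1).resolve_left (by linarith)
  have f2 : M * δp - δq = 0 := (mul_eq_zero.1 e2).resolve_left (by linarith)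
  have f3 : M * δp = 0 := by linarith
  have f4 : δp = 0 := (mul_eq_zero.1 f3).resolve_left hM0.ne'
  exact ⟨f4, by linarith⟩

/-- The recursion is implicit in the values at `N + 1`, so the induction on `N` must establish
summability before the sums can be identified with the given solution. -/
theorem hasSum_gradedSum {κ τ lam : ℝ} (hκ0 : 0 ≤ κ) (hκ : κ ≤ 1) (hτ : 0 ≤ τ) (hlam : 0 ≤ lam)
    (hu : lam * τ + lam < 1) {p q : ℕ → ℝ} (hp0 : p 0 = 1) (hq0 : q 0 = 0)
    (hp : ∀ N : ℕ, p (N + 1) = p N + lam * τ / ((N + 1 : ℕ) : ℝ) ^ 2 * (p (N + 1) - κ) +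
      lam / ((N + 1 : ℕ) : ℝ) ^ 3 * q (N + 1))
    (hq : ∀ N : ℕ, q (N + 1) = q N + lam * τ / ((N + 1 : ℕ) : ℝ) ^ 2 * q (N + 1) +
      lam / ((N + 1 : ℕ) : ℝ) * p (N + 1)) (N : ℕ) :
    HasSum (fun w => gradedSum κ τ evenInd N w * lam ^ w) (p N) ∧
      HasSum (fun w => gradedSum κ τ oddInd N w * lam ^ w) (q N) := by
  have h0e : evenInd 0 = 1 := by simp [evenInd]
  have h0o : oddInd 0 = 0 := by simp [oddInd]
  induction N with
  | zero =>
    rw [hp0, hq0]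
    constructor
    · have h := hasSum_single (f := fun w => gradedSum κ τ evenInd 0 w * lam ^ w) 0 fun w hw => by
        obtain ⟨w, rfl⟩ := Nat.exists_eq_succ_of_ne_zero hw
        rw [Nat.succ_eq_add_one, gradedSum_zero_left, zero_mul]
      simpa [gradedSum_zero_right, h0e] using h
    · have h := hasSum_single (f := fun w => gradedSum κ τ oddInd 0 w * lam ^ w) 0 fun w hw => by
        obtain ⟨w, rfl⟩ := Nat.exists_eq_succ_of_ne_zero hw
        rw [Nat.succ_eq_add_one, gradedSum_zero_left, zero_mul]
      simpa [gradedSum_zero_right, h0o] using h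
  | succ N ih =>
    set M : ℝ := ((N + 1 : ℕ) : ℝ) with hMdef
    have hM : 1 ≤ M := by
      rw [hMdef]
      exact_mod_cast Nat.succ_le_succ (Nat.zero_le N)
    have hx : 0 ≤ lam * τ := mul_nonneg hlam hτ
    have nonneg : ∀ (ε : ℕ → ℝ), (∀ m, 0 ≤ ε m) → ∀ N w, 0 ≤ gradedSum κ τ ε N w * lam ^ w :=
      fun ε hε N w => mul_nonneg (gradedSum_nonneg hκ hτ hε N w) (pow_nonneg hlam w)
    have har : ∀ w, gradedSum κ τ evenInd (N + 1) (w + 1) * lam ^ (w + 1) =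
        gradedSum κ τ evenInd N (w + 1) * lam ^ (w + 1) + lam * τ / M ^ 2 *
          (gradedSum κ τ evenInd (N + 1) w * lam ^ w - if w = 0 then κ else 0) +
        lam / M ^ 3 * (gradedSum κ τ oddInd (N + 1) w * lam ^ w) := by
      intro w
      rw [gradedSum_evenInd_rec]
      by_cases hw : w = 0
      · subst hw
        simp only [if_true]
        ring
      · simp only [if_neg hw]
        ring
    have hbr : ∀ w, gradedSum κ τ oddInd (N + 1) (w + 1) * lam ^ (w + 1) =
        gradedSum κ τ oddInd N (w + 1) * lam ^ (w + 1) + lam * τ / M ^ 2 *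
          (gradedSum κ τ oddInd (N + 1) w * lam ^ w) +
        lam / M * (gradedSum κ τ evenInd (N + 1) w * lam ^ w) := by
      intro w
      rw [gradedSum_oddInd_rec]
      ring
    have ha0 : gradedSum κ τ evenInd (N + 1) 0 * lam ^ 0 =
        gradedSum κ τ evenInd N 0 * lam ^ 0 := by simp only [gradedSum_zero_right]
    have hb0 : gradedSum κ τ oddInd (N + 1) 0 * lam ^ 0 =
        gradedSum κ τ oddInd N 0 * lam ^ 0 := by simp only [gradedSum_zero_right]
    obtain ⟨sa, sb⟩ := summable_of_coupled_rec
      (a := fun w => gradedSum κ τ evenInd (N + 1) w * lam ^ w)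
      (b := fun w => gradedSum κ τ oddInd (N + 1) w * lam ^ w)
      hM hx hlam hu hκ0 (nonneg _ evenInd_nonneg _) (nonneg _ oddInd_nonneg _)
      (nonneg _ evenInd_nonneg _) (nonneg _ oddInd_nonneg _) ih.1 ih.2 ha0 hb0 har hbr
    obtain ⟨ea, eb⟩ := tsum_of_coupled_rec ih.1 ih.2 ha0 hb0 har hbr sa sb
    have hpN := hp N
    have hqN := hq N
    -- The differences between the sums of the series and the given solution satisfy the homogeneous
    -- system.
    obtain ⟨da, db⟩ := coupled_linear_unique hM hlam hu
      (δp := ∑' w, gradedSum κ τ evenInd (N + 1) w * lam ^ w - p (N + 1))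
      (δq := ∑' w, gradedSum κ τ oddInd (N + 1) w * lam ^ w - q (N + 1))
      (by linear_combination ea - hpN) (by linear_combination eb - hqN)
    rw [← sub_eq_zero.1 da, ← sub_eq_zero.1 db]
    exact ⟨sa.hasSum, sb.hasSum⟩

/-! ### Expansions in central binomial ratios -/

/-- The ratio `N! ^ 2 / ((N - k)! (N + k)!)`, which is `0` for `k > N`. -/
noncomputable def centralRatio (N k : ℕ) : ℝ :=
  ∏ j ∈ Finset.range k, ((N : ℝ) - j) / (N + j + 1)

theorem centralRatio_zero (N : ℕ) : centralRatio N 0 = 1 := by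
  simp [centralRatio]

theorem centralRatio_succ (N k : ℕ) :
    centralRatio N (k + 1) = centralRatio N k * (((N : ℝ) - k) / (N + k + 1)) :=
  Finset.prod_range_succ _ _

theorem centralRatio_eq_zero {N k : ℕ} (h : N < k) : centralRatio N k = 0 :=
  Finset.prod_eq_zero (Finset.mem_range.2 h) (by simp)

theorem centralRatio_mem_Icc (N k : ℕ) : centralRatio N k ∈ Set.Icc (0 : ℝ) 1 := by
  rcases lt_or_ge N k with h | h
  · simp [centralRatio_eq_zero h]
  · have hj : ∀ j ∈ Finset.range k, (j : ℝ) ≤ N := fun j hj => by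
      exact_mod_cast (Finset.mem_range.1 hj).le.trans h
    refine ⟨Finset.prod_nonneg fun j hj' => div_nonneg (by linarith [hj j hj']) (by positivity),
      Finset.prod_le_one (fun j hj' => div_nonneg (by linarith [hj j hj']) (by positivity))
        fun j hj' => ?_⟩
    rw [div_le_one (by positivity)]
    have : (0 : ℝ) ≤ j := Nat.cast_nonneg j
    linarith

theorem tendsto_centralRatio (k : ℕ) :
    Filter.Tendsto (fun N => centralRatio N k) Filter.atTop (nhds 1) := by
  have h : ∀ j ∈ Finset.range k, Filter.Tendsto (fun N : ℕ => ((N : ℝ) - j) / (N + j + 1))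
      Filter.atTop (nhds 1) := by
    intro j _
    have h1 : Filter.Tendsto (fun N : ℕ => 1 - (2 * (j : ℝ) + 1) / ((N : ℝ) + (j + 1)))
        Filter.atTop (nhds (1 - 0)) := by
      refine tendsto_const_nhds.sub (Filter.Tendsto.div_atTop tendsto_const_nhds ?_)
      exact Filter.tendsto_atTop_add_const_right _ _ tendsto_natCast_atTop_atTop
    rw [sub_zero] at h1
    refine h1.congr fun N => ?_
    have : (N : ℝ) + j + 1 ≠ 0 := by positivity
    have : (N : ℝ) + (j + 1) ≠ 0 := by positivity
    field_simp
    ring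
  simpa [centralRatio] using tendsto_finsetProd (Finset.range k) h

/-- Equivalently, `(N+1)² (c(N+1,k) - c(N,k)) = k² c(N+1,k)`: differencing in `N` becomes
multiplication by `k²`. -/
theorem sq_sub_sq_mul_centralRatio (N k : ℕ) :
    (((N + 1 : ℕ) : ℝ) ^ 2 - (k : ℝ) ^ 2) * centralRatio (N + 1) k =
      ((N + 1 : ℕ) : ℝ) ^ 2 * centralRatio N k := by
  induction k with
  | zero => simp [centralRatio_zero]
  | succ k ih =>
    rw [centralRatio_succ, centralRatio_succ, ← mul_assoc _ (centralRatio N k), ← ih]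
    push_cast
    have h1 : (N : ℝ) + 1 + k + 1 ≠ 0 := by positivity
    have h2 : (N : ℝ) + k + 1 ≠ 0 := by positivity
    field_simp
    ring

/-- Summation by parts, based on `(N - k) c(N,k) = (N + k + 1) c(N,k+1)`. The boundary term vanishes
for `K = N`. -/
theorem centralRatio_abel (N K : ℕ) (E : ℕ → ℝ) :
    N * (E 0 + ∑ k ∈ Finset.range K, (E (k + 1) - E k) * centralRatio N (k + 1)) =
      ∑ k ∈ Finset.range K, ((k : ℝ) + 1) * (E (k + 1) + E k) * centralRatio N (k + 1) +
        ((N : ℝ) - K) * centralRatio N K * E K := by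
  induction K with
  | zero => simp [centralRatio_zero]
  | succ K ih =>
    rw [Finset.sum_range_succ, Finset.sum_range_succ, ← add_assoc, mul_add, ih, centralRatio_succ]
    have h : (N : ℝ) + K + 1 ≠ 0 := by positivity
    push_cast
    field_simp
    ring

theorem centralRatio_abel_self (N : ℕ) (E : ℕ → ℝ) :
    N * (E 0 + ∑ k ∈ Finset.range N, (E (k + 1) - E k) * centralRatio N (k + 1)) =
      ∑ k ∈ Finset.range N, ((k : ℝ) + 1) * (E (k + 1) + E k) * centralRatio N (k + 1) := by
  simpa using centralRatio_abel N N E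

theorem sq_mul_sum_centralRatio_sub (N : ℕ) (f : ℕ → ℝ) :
    ((N + 1 : ℕ) : ℝ) ^ 2 * (∑ k ∈ Finset.range (N + 1), f k * centralRatio (N + 1) (k + 1) -
      ∑ k ∈ Finset.range N, f k * centralRatio N (k + 1)) =
    ∑ k ∈ Finset.range (N + 1), ((k : ℝ) + 1) ^ 2 * f k * centralRatio (N + 1) (k + 1) := by
  -- The added term contains `c(N, N+1) = 0`, so both sums may run over the same range.
  have h : ∑ k ∈ Finset.range N, f k * centralRatio N (k + 1) =
      ∑ k ∈ Finset.range (N + 1), f k * centralRatio N (k + 1) := by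
    rw [Finset.sum_range_succ, centralRatio_eq_zero (Nat.lt_succ_self N), mul_zero, add_zero]
  rw [h, ← Finset.sum_sub_distrib, Finset.mul_sum]
  refine Finset.sum_congr rfl fun k _ => ?_
  have := sq_sub_sq_mul_centralRatio N (k + 1)
  push_cast at this ⊢
  linear_combination f k * this

/-- The expansion of a sequence with increments of `C` as coefficients in `centralRatio`. -/
noncomputable def ratioSum (C : ℕ → ℝ) (N : ℕ) : ℝ :=
  C 0 + ∑ k ∈ Finset.range N, (C (k + 1) - C k) * centralRatio N (k + 1)

/-- The second component of the solution of the coupled recursion. -/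
noncomputable def ratioSumCompanion (y : ℝ) (E : ℕ → ℝ) (N : ℕ) : ℝ :=
  ∑ k ∈ Finset.range N, ((k : ℝ) + 1) * (E (k + 1) + E k) / y * centralRatio N (k + 1)

/-- After multiplication by `(N+1)²` the recursion can be read off coefficientwise in the basis
`c(N+1,k)`: `h1` matches the coefficients and `hE0` the constant term. -/
theorem ratioSum_rec {x y κ : ℝ} (hy : y ≠ 0) {C E : ℕ → ℝ} (hC0 : C 0 = 1)
    (hE0 : E 0 = -(1 - κ) * x)
    (h1 : ∀ k : ℕ, E (k + 1) - E k = (((k : ℝ) + 1) ^ 2 - x) * (C (k + 1) - C k)) (N : ℕ) :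
    ratioSum C (N + 1) = ratioSum C N +
      x / ((N + 1 : ℕ) : ℝ) ^ 2 * (ratioSum C (N + 1) - κ) +
      y / ((N + 1 : ℕ) : ℝ) ^ 3 * ratioSumCompanion y E (N + 1) := by
  have hM : ((N + 1 : ℕ) : ℝ) ≠ 0 := by positivity
  have hq : y * ratioSumCompanion y E (N + 1) = ((N + 1 : ℕ) : ℝ) * (E 0 +
      ∑ k ∈ Finset.range (N + 1), (E (k + 1) - E k) * centralRatio (N + 1) (k + 1)) := by
    rw [centralRatio_abel_self, ratioSumCompanion, Finset.mul_sum]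
    refine Finset.sum_congr rfl fun k _ => ?_
    field_simp
  have hs := sq_mul_sum_centralRatio_sub N fun k => C (k + 1) - C k
  have he : ∑ k ∈ Finset.range (N + 1), (E (k + 1) - E k) * centralRatio (N + 1) (k + 1) =
      ∑ k ∈ Finset.range (N + 1),
        ((k : ℝ) + 1) ^ 2 * (C (k + 1) - C k) * centralRatio (N + 1) (k + 1) -
      x * ∑ k ∈ Finset.range (N + 1), (C (k + 1) - C k) * centralRatio (N + 1) (k + 1) := by
    rw [Finset.mul_sum, ← Finset.sum_sub_distrib]
    refine Finset.sum_congr rfl fun k _ => ?_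
    rw [h1]
    ring
  rw [he, ← hs, hE0] at hq
  simp only [ratioSum, hC0]
  field_simp
  linear_combination -hq

theorem ratioSumCompanion_rec {x y : ℝ} (hy : y ≠ 0) {C E : ℕ → ℝ}
    (h2 : ∀ k : ℕ, (((k : ℝ) + 1) ^ 2 - x) * (E (k + 1) + E k) = y ^ 2 * (C (k + 1) + C k))
    (N : ℕ) :
    ratioSumCompanion y E (N + 1) = ratioSumCompanion y E N +
      x / ((N + 1 : ℕ) : ℝ) ^ 2 * ratioSumCompanion y E (N + 1) +
      y / ((N + 1 : ℕ) : ℝ) * ratioSum C (N + 1) := by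
  have hM : ((N + 1 : ℕ) : ℝ) ≠ 0 := by positivity
  have hs := sq_mul_sum_centralRatio_sub N fun k => ((k : ℝ) + 1) * (E (k + 1) + E k) / y
  have hp := centralRatio_abel_self (N + 1) C
  have he : y * ∑ k ∈ Finset.range (N + 1),
        ((k : ℝ) + 1) * (C (k + 1) + C k) * centralRatio (N + 1) (k + 1) =
      ∑ k ∈ Finset.range (N + 1),
        ((k : ℝ) + 1) ^ 2 * (((k : ℝ) + 1) * (E (k + 1) + E k) / y) *
          centralRatio (N + 1) (k + 1) -
      x * ∑ k ∈ Finset.range (N + 1), ((k : ℝ) + 1) * (E (k + 1) + E k) / y *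
          centralRatio (N + 1) (k + 1) := by
    rw [Finset.mul_sum, Finset.mul_sum, ← Finset.sum_sub_distrib]
    refine Finset.sum_congr rfl fun k _ => ?_
    field_simp
    linear_combination -centralRatio (N + 1) (k + 1) * h2 k
  rw [← hs, ← hp] at he
  simp only [ratioSum, ratioSumCompanion] at he ⊢
  field_simp at he ⊢
  linear_combination -he

/-- Dominated convergence, from `0 ≤ c(N,k) ≤ 1` and `c(N,k) → 1`; the limiting series telescopes.
-/
theorem tendsto_ratioSum {C : ℕ → ℝ} {L : ℝ} (hC : Filter.Tendsto C Filter.atTop (nhds L))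
    (hs : Summable fun k => |C (k + 1) - C k|) :
    Filter.Tendsto (ratioSum C) Filter.atTop (nhds L) := by
  have h1 : ∀ N, ratioSum C N = C 0 + ∑' k, (C (k + 1) - C k) * centralRatio N (k + 1) := by
    intro N
    rw [ratioSum, tsum_eq_sum fun k hk => ?_]
    rw [centralRatio_eq_zero (Nat.lt_succ_of_le (not_lt.1 fun h => hk (Finset.mem_range.2 h))),
      mul_zero]
  have h2 : Filter.Tendsto (fun N => ∑' k, (C (k + 1) - C k) * centralRatio N (k + 1))
      Filter.atTop (nhds (∑' k, (C (k + 1) - C k))) := by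
    refine tendsto_tsum_of_dominated_convergence hs (fun k => ?_)
      (Filter.Eventually.of_forall fun N k => ?_)
    · simpa using (tendsto_centralRatio (k + 1)).const_mul (C (k + 1) - C k)
    · obtain ⟨h0, h1⟩ := centralRatio_mem_Icc N (k + 1)
      rw [Real.norm_eq_abs, abs_mul, abs_of_nonneg h0]
      exact mul_le_of_le_one_right (abs_nonneg _) h1
  have h3 : ∑' k, (C (k + 1) - C k) = L - C 0 := by
    have h4 := hs.of_abs.hasSum.tendsto_sum_nat
    refine tendsto_nhds_unique h4 ?_
    refine (hC.sub_const (C 0)).congr fun n => ?_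
    rw [Finset.sum_range_sub]
  rw [h3] at h2
  have := h2.const_add (C 0)
  rw [add_sub_cancel] at this
  exact this.congr fun N => (h1 N).symm

/-! ### Explicit solution by alternating products -/

/-- The products with factors `(j² - v) / (j² - u)` for odd `j` and `(j² - u) / (j² - v)` for
even `j`. -/
noncomputable def altProd (u v : ℝ) : ℕ → ℝ
  | 0 => 1
  | j + 1 => altProd u v j *
      if Even j then (((j : ℝ) + 1) ^ 2 - v) / (((j : ℝ) + 1) ^ 2 - u)
      else (((j : ℝ) + 1) ^ 2 - u) / (((j : ℝ) + 1) ^ 2 - v)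

theorem one_sub_le_sq_sub {u : ℝ} (k : ℕ) (hu0 : 0 ≤ u) :
    (1 - u) * ((k : ℝ) + 1) ^ 2 ≤ ((k : ℝ) + 1) ^ 2 - u := by
  have h : (1 : ℝ) ≤ ((k : ℝ) + 1) ^ 2 := one_le_pow₀ (by linarith [k.cast_nonneg (α := ℝ)])
  nlinarith

theorem sq_sub_pos {u : ℝ} (k : ℕ) (hu : u < 1) : 0 < ((k : ℝ) + 1) ^ 2 - u := by
  have h : (1 : ℝ) ≤ ((k : ℝ) + 1) ^ 2 := one_le_pow₀ (by linarith [k.cast_nonneg (α := ℝ)])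
  linarith

theorem altProd_pos {u v : ℝ} (hu : u < 1) (hv : v < 1) (j : ℕ) : 0 < altProd u v j := by
  induction j with
  | zero => simp [altProd]
  | succ j ih =>
    rw [altProd]
    refine mul_pos ih ?_
    have := sq_sub_pos j hu
    have := sq_sub_pos j hv
    split_ifs <;> positivity

/-- The coefficient sums in the `centralRatio` expansion of the solution. -/
noncomputable def altDiff (x y P Q : ℝ) (j : ℕ) : ℝ :=
  (P / altProd (x + y) (x - y) j - Q * altProd (x + y) (x - y) j) / (2 * y)

/-- The companion of `altDiff`. -/
noncomputable def altMean (x y P Q : ℝ) (j : ℕ) : ℝ :=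
  (-1) ^ j * (P / altProd (x + y) (x - y) j + Q * altProd (x + y) (x - y) j) / 2

section alt

variable {x y : ℝ} (P Q : ℝ)

/-- Write `E`, `C` for `altMean`, `altDiff` at `k`, `E'`, `C'` for their values at `k + 1`, and `m =
(k+1)²`. This identity and `altMean_add` together amount to `E' ∓ yC' = -(m - (x ± y)) / (m - (x ∓
y)) * (E ± yC)`. Thus `E + yC` and `E - yC` swap roles at each step, whence the alternation in
`altProd` and the sign `(-1) ^ j`. -/
theorem altMean_sub (hy : 0 < y) (hu : x + y < 1) (k : ℕ) :
    altMean x y P Q (k + 1) - altMean x y P Q k =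
      (((k : ℝ) + 1) ^ 2 - x) * (altDiff x y P Q (k + 1) - altDiff x y P Q k) := by
  have hR := (altProd_pos hu (show x - y < 1 by linarith) k).ne'
  have h1 := (sq_sub_pos k hu).ne'
  have h2 := (sq_sub_pos k (show x - y < 1 by linarith)).ne'
  simp only [altMean, altDiff, altProd]
  set R := altProd (x + y) (x - y) k
  set m := ((k : ℝ) + 1) ^ 2
  by_cases hk : Even k
  · rw [if_pos hk, hk.neg_one_pow, hk.add_one.neg_one_pow]
    field_simp
    ring
  · rw [if_neg hk, (Nat.not_even_iff_odd.1 hk).neg_one_pow,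
      (Nat.not_even_iff_odd.1 hk).add_one.neg_one_pow]
    field_simp
    ring

theorem altMean_add (hy : 0 < y) (hu : x + y < 1) (k : ℕ) :
    (((k : ℝ) + 1) ^ 2 - x) * (altMean x y P Q (k + 1) + altMean x y P Q k) =
      y ^ 2 * (altDiff x y P Q (k + 1) + altDiff x y P Q k) := by
  have hR := (altProd_pos hu (show x - y < 1 by linarith) k).ne'
  have h1 := (sq_sub_pos k hu).ne'
  have h2 := (sq_sub_pos k (show x - y < 1 by linarith)).ne'
  simp only [altMean, altDiff, altProd]
  set R := altProd (x + y) (x - y) k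
  set m := ((k : ℝ) + 1) ^ 2
  by_cases hk : Even k
  · rw [if_pos hk, hk.neg_one_pow, hk.add_one.neg_one_pow]
    field_simp
    ring
  · rw [if_neg hk, (Nat.not_even_iff_odd.1 hk).neg_one_pow,
      (Nat.not_even_iff_odd.1 hk).add_one.neg_one_pow]
    field_simp
    ring

/-- Each factor of `altProd` and its inverse differ from 1 by `±2y` over a denominator of order
`k²`; the `2y` cancels the one in `altDiff`. -/
theorem abs_altDiff_sub_le (hy : 0 < y) (hx : y ≤ x) (hu : x + y < 1) (k : ℕ) :
    |altDiff x y P Q (k + 1) - altDiff x y P Q k| ≤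
      (|P / altProd (x + y) (x - y) k| + |Q * altProd (x + y) (x - y) k|) / (1 - (x + y)) *
        (1 / ((k : ℝ) + 1) ^ 2) := by
  have hv : x - y < 1 := by linarith
  have hR := (altProd_pos hu hv k).ne'
  have p1 := sq_sub_pos k hu
  have p2 := sq_sub_pos k hv
  have b1 := one_sub_le_sq_sub k (show 0 ≤ x + y by linarith)
  have hm : 0 < ((k : ℝ) + 1) ^ 2 := by positivity
  have hu' : 0 < 1 - (x + y) := by linarith
  have b2 : (1 - (x + y)) * ((k : ℝ) + 1) ^ 2 ≤ ((k : ℝ) + 1) ^ 2 - (x - y) := by linarith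
  have hform : ∃ A B : ℝ, ((1 - (x + y)) * ((k : ℝ) + 1) ^ 2 ≤ A) ∧
      ((1 - (x + y)) * ((k : ℝ) + 1) ^ 2 ≤ B) ∧
      (altDiff x y P Q (k + 1) - altDiff x y P Q k = P / altProd (x + y) (x - y) k / A +
        Q * altProd (x + y) (x - y) k / B ∨
      altDiff x y P Q (k + 1) - altDiff x y P Q k = -(P / altProd (x + y) (x - y) k / A +
        Q * altProd (x + y) (x - y) k / B)) := by
    by_cases hk : Even k
    · refine ⟨_, _, b2, b1, Or.inr ?_⟩
      simp only [altDiff, altProd, if_pos hk]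
      set R := altProd (x + y) (x - y) k
      set m := ((k : ℝ) + 1) ^ 2
      field_simp
      ring
    · refine ⟨_, _, b1, b2, Or.inl ?_⟩
      simp only [altDiff, altProd, if_neg hk]
      set R := altProd (x + y) (x - y) k
      set m := ((k : ℝ) + 1) ^ 2
      field_simp
      ring
  obtain ⟨A, B, hA, hB, h⟩ := hform
  have hpos : 0 < (1 - (x + y)) * ((k : ℝ) + 1) ^ 2 := mul_pos hu' hm
  have h' : |altDiff x y P Q (k + 1) - altDiff x y P Q k| =
      |P / altProd (x + y) (x - y) k / A + Q * altProd (x + y) (x - y) k / B| := by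
    rcases h with h | h
    · rw [h]
    · rw [h, abs_neg]
  rw [h']
  refine (abs_add_le _ _).trans ?_
  rw [abs_div _ A, abs_div _ B, abs_of_pos (hpos.trans_le hA), abs_of_pos (hpos.trans_le hB)]
  calc _ ≤ |P / altProd (x + y) (x - y) k| / ((1 - (x + y)) * ((k : ℝ) + 1) ^ 2) +
        |Q * altProd (x + y) (x - y) k| / ((1 - (x + y)) * ((k : ℝ) + 1) ^ 2) := by gcongr
    _ = _ := by field_simp

theorem summable_abs_altDiff_sub (hy : 0 < y) (hx : y ≤ x) (hu : x + y < 1) {ρ : ℝ} (hρ : ρ ≠ 0)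
    (h : Filter.Tendsto (altProd (x + y) (x - y)) Filter.atTop (nhds ρ)) :
    Summable fun k => |altDiff x y P Q (k + 1) - altDiff x y P Q k| := by
  have h1 : Filter.Tendsto (fun k => (|P / altProd (x + y) (x - y) k| +
      |Q * altProd (x + y) (x - y) k|) / (1 - (x + y))) Filter.atTop
      (nhds ((|P / ρ| + |Q * ρ|) / (1 - (x + y)))) :=
    ((((tendsto_const_nhds (x := P)).div h hρ).abs.add (h.const_mul Q).abs)).div_const _
  obtain ⟨K, hK⟩ := h1.bddAbove_range
  have hs : Summable fun k : ℕ => K * (1 / ((k : ℝ) + 1) ^ 2) := by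
    refine Summable.mul_left K ?_
    have := (summable_nat_add_iff 1).2 (Real.summable_one_div_nat_pow.2 (one_lt_two))
    simpa using this
  refine Summable.of_nonneg_of_le (fun k => abs_nonneg _) (fun k => ?_) hs
  refine (abs_altDiff_sub_le P Q hy hx hu k).trans ?_
  exact mul_le_mul_of_nonneg_right (hK ⟨k, rfl⟩) (by positivity)

theorem tendsto_altDiff {ρ : ℝ} (hρ : ρ ≠ 0)
    (h : Filter.Tendsto (altProd (x + y) (x - y)) Filter.atTop (nhds ρ)) :
    Filter.Tendsto (altDiff x y P Q) Filter.atTop (nhds ((P / ρ - Q * ρ) / (2 * y))) :=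
  (((tendsto_const_nhds (x := P)).div h hρ).sub (h.const_mul Q)).div_const _

end alt

/-! ### Limit of the alternating product -/

theorem tendsto_of_tendsto_even_odd {f : ℕ → ℝ} {L : ℝ}
    (h0 : Filter.Tendsto (fun i => f (2 * i)) Filter.atTop (nhds L))
    (h1 : Filter.Tendsto (fun i => f (2 * i + 1)) Filter.atTop (nhds L)) :
    Filter.Tendsto f Filter.atTop (nhds L) := by
  rw [Metric.tendsto_atTop] at *
  intro ε hε
  obtain ⟨a, ha⟩ := h0 ε hε
  obtain ⟨b, hb⟩ := h1 ε hε
  refine ⟨2 * (a + b), fun n hn => ?_⟩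
  rcases Nat.even_or_odd' n with ⟨i, rfl | rfl⟩
  · exact ha i (by omega)
  · exact hb i (by omega)

/-- The product of `1 - u / j²` over the even `j ≤ 2i`. -/
noncomputable def evenProd (u : ℝ) (i : ℕ) : ℝ :=
  ∏ l ∈ Finset.range i, (1 - u / (2 * (l : ℝ) + 2) ^ 2)

/-- The product of `1 - u / j²` over the odd `j < 2i`. -/
noncomputable def oddProd (u : ℝ) (i : ℕ) : ℝ :=
  ∏ l ∈ Finset.range i, (1 - u / (2 * (l : ℝ) + 1) ^ 2)

theorem tendsto_prod_one_sub_sq {a : ℝ} (ha : 0 < a) :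
    Filter.Tendsto (fun n => ∏ j ∈ Finset.range n, (1 - a ^ 2 / ((j : ℝ) + 1) ^ 2)) Filter.atTop
      (nhds (Real.sin (Real.pi * a) / (Real.pi * a))) := by
  have hπ := Real.pi_pos
  refine ((Real.tendsto_euler_sin_prod a).div_const (Real.pi * a)).congr fun n => ?_
  field_simp

theorem tendsto_evenProd {a : ℝ} (ha : 0 < a) :
    Filter.Tendsto (evenProd (a ^ 2)) Filter.atTop
      (nhds (Real.sin (Real.pi * a / 2) / (Real.pi * a / 2))) := by
  have h := tendsto_prod_one_sub_sq (half_pos ha)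
  rw [← mul_div_assoc] at h
  refine h.congr fun n => Finset.prod_congr rfl fun l _ => ?_
  have : (l : ℝ) + 1 ≠ 0 := by positivity
  have : 2 * (l : ℝ) + 2 ≠ 0 := by positivity
  field_simp

theorem prod_range_two_mul (u : ℝ) (i : ℕ) :
    ∏ j ∈ Finset.range (2 * i), (1 - u / ((j : ℝ) + 1) ^ 2) = oddProd u i * evenProd u i := by
  induction i with
  | zero => simp [oddProd, evenProd]
  | succ i ih =>
    rw [show 2 * (i + 1) = 2 * i + 1 + 1 by ring, Finset.prod_range_succ, Finset.prod_range_succ,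
      ih, oddProd, oddProd, evenProd, evenProd, Finset.prod_range_succ, Finset.prod_range_succ]
    push_cast
    ring

/-- The full sine product divided by its even part leaves the odd part, and `sin 2z = 2 sin z cos z`
evaluates the quotient. -/
theorem tendsto_oddProd {a : ℝ} (ha : 0 < a) (ha1 : a < 1) :
    Filter.Tendsto (oddProd (a ^ 2)) Filter.atTop (nhds (Real.cos (Real.pi * a / 2))) := by
  have hπ := Real.pi_pos
  have hs : 0 < Real.sin (Real.pi * a / 2) :=
    Real.sin_pos_of_pos_of_lt_pi (by positivity) (by nlinarith)
  have h2 : Filter.Tendsto (fun i : ℕ => 2 * i) Filter.atTop Filter.atTop :=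
    Filter.tendsto_id.const_mul_atTop' (by norm_num)
  have h := ((tendsto_prod_one_sub_sq ha).comp h2).div (tendsto_evenProd ha) (by positivity)
  have e : Real.sin (Real.pi * a) / (Real.pi * a) /
      (Real.sin (Real.pi * a / 2) / (Real.pi * a / 2)) = Real.cos (Real.pi * a / 2) := by
    rw [show Real.pi * a = 2 * (Real.pi * a / 2) by ring, Real.sin_two_mul]
    field_simp
  rw [e] at h
  refine h.congr fun i => ?_
  have hne : evenProd (a ^ 2) i ≠ 0 := by
    refine Finset.prod_ne_zero_iff.2 fun l _ => ?_
    have h3 : a ^ 2 / (2 * (l : ℝ) + 2) ^ 2 < 1 := by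
      rw [div_lt_one (by positivity)]
      have : (0 : ℝ) ≤ l := Nat.cast_nonneg l
      nlinarith
    linarith
  simp only [Function.comp_apply, Pi.div_apply, prod_range_two_mul]
  field_simp

theorem sub_div_sub_eq {m u v : ℝ} (hm : m ≠ 0) :
    (m - v) / (m - u) = (1 - v / m) / (1 - u / m) := by
  rw [one_sub_div hm, one_sub_div hm, div_div_div_cancel_right₀ hm]

theorem altProd_two_mul_add_one (u v : ℝ) (i : ℕ) :
    altProd u v (2 * i + 1) = altProd u v (2 * i) *
      ((1 - v / (2 * (i : ℝ) + 1) ^ 2) / (1 - u / (2 * (i : ℝ) + 1) ^ 2)) := by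
  rw [altProd, if_pos (even_two_mul i), sub_div_sub_eq (by positivity)]
  push_cast
  rfl

theorem altProd_two_mul (u v : ℝ) (i : ℕ) :
    altProd u v (2 * i) = oddProd v i / oddProd u i * (evenProd u i / evenProd v i) := by
  induction i with
  | zero => simp [altProd, oddProd, evenProd]
  | succ i ih =>
    rw [show 2 * (i + 1) = 2 * i + 1 + 1 by ring, altProd,
      if_neg (Nat.not_even_iff_odd.2 (odd_two_mul_add_one i)), sub_div_sub_eq (by positivity),
      altProd_two_mul_add_one, ih]
    simp only [oddProd, evenProd, Finset.prod_range_succ]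
    push_cast
    rw [show (2 * (i : ℝ) + 1 + 1) = 2 * i + 2 by ring]
    simp only [div_eq_mul_inv, mul_inv]
    ring

theorem tendsto_altProd {a b : ℝ} (ha : 0 < a) (ha1 : a < 1) (hb : 0 < b) (hb1 : b < 1) :
    Filter.Tendsto (altProd (a ^ 2) (b ^ 2)) Filter.atTop
      (nhds (Real.tan (Real.pi * a / 2) / (Real.pi * a / 2) *
        (Real.pi * b / 2 * Real.cot (Real.pi * b / 2)))) := by
  have hπ := Real.pi_pos
  have hs : 0 < Real.sin (Real.pi * b / 2) :=
    Real.sin_pos_of_pos_of_lt_pi (by positivity) (by nlinarith)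
  have hc : 0 < Real.cos (Real.pi * a / 2) :=
    Real.cos_pos_of_mem_Ioo ⟨by nlinarith, by nlinarith⟩
  have h0 := ((tendsto_oddProd hb hb1).div (tendsto_oddProd ha ha1) hc.ne').mul
    ((tendsto_evenProd ha).div (tendsto_evenProd hb) (by positivity))
  have e : Real.cos (Real.pi * b / 2) / Real.cos (Real.pi * a / 2) *
      (Real.sin (Real.pi * a / 2) / (Real.pi * a / 2) /
        (Real.sin (Real.pi * b / 2) / (Real.pi * b / 2))) =
      Real.tan (Real.pi * a / 2) / (Real.pi * a / 2) *
        (Real.pi * b / 2 * Real.cot (Real.pi * b / 2)) := by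
    rw [Real.tan_eq_sin_div_cos, Real.cot_eq_cos_div_sin]
    field_simp
  rw [e] at h0
  have h0' : Filter.Tendsto (fun i => altProd (a ^ 2) (b ^ 2) (2 * i)) Filter.atTop _ :=
    h0.congr fun i => (altProd_two_mul _ _ i).symm
  refine tendsto_of_tendsto_even_odd h0' ?_
  -- Passing from index `2i` to `2i + 1` adds a single factor, which tends to 1.
  have hfac : ∀ c : ℝ, Filter.Tendsto (fun i : ℕ => 1 - c / (2 * (i : ℝ) + 1) ^ 2) Filter.atTop
      (nhds 1) := by
    intro c
    have h3 : Filter.Tendsto (fun i : ℕ => (2 * (i : ℝ) + 1) ^ 2) Filter.atTop Filter.atTop := by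
      refine (Filter.tendsto_pow_atTop two_ne_zero).comp ?_
      exact Filter.tendsto_atTop_add_const_right _ _
        (tendsto_natCast_atTop_atTop.const_mul_atTop two_pos)
    simpa using (tendsto_const_nhds (x := (1 : ℝ))).sub
      ((tendsto_const_nhds (x := c)).div_atTop h3)
  have h1 := h0'.mul ((hfac (b ^ 2)).div (hfac (a ^ 2)) one_ne_zero)
  rw [div_one, mul_one] at h1
  exact h1.congr fun i => (altProd_two_mul_add_one _ _ i).symm

/-! ### Bernoulli expansions of cotangent and tangent -/

theorem hasSum_one_sub_pi_mul_cot {x : ℝ} (hx : 0 < x) (hx1 : x < 1) :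
    HasSum (fun n : ℕ => 2 * x ^ 2 / (((n : ℝ) + 1) ^ 2 - x ^ 2))
      (1 - Real.pi * x * Real.cot (Real.pi * x)) := by
  have hpos : ∀ n : ℕ, 0 < ((n : ℝ) + 1) ^ 2 - x ^ 2 := fun n => sq_sub_pos n (by nlinarith)
  rw [hasSum_iff_tendsto_nat_of_nonneg
    (fun n => div_nonneg (by positivity) (hpos n).le)]
  have hmem : (x : ℂ) ∈ Complex.integerComplement := by
    rw [Complex.mem_integerComplement_iff]
    rintro ⟨n, hn⟩
    have hn' : (n : ℝ) = x := by exact_mod_cast hn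
    have h0 : 0 < n := by
      have : (0 : ℝ) < n := hn' ▸ hx
      exact_mod_cast this
    have h1 : n < 1 := by
      have : (n : ℝ) < 1 := hn' ▸ hx1
      exact_mod_cast this
    omega
  have h := (Complex.continuous_re.tendsto _).comp
    ((tendsto_logDeriv_euler_cot_sub hmem).const_mul (-(x : ℂ)))
  have e : (-(x : ℂ) * (Real.pi * Complex.cot (Real.pi * x) - 1 / x)).re =
      1 - Real.pi * x * Real.cot (Real.pi * x) := by
    have : -(x : ℂ) * (Real.pi * Complex.cot (Real.pi * x) - 1 / x) =
        ((1 - Real.pi * x * Real.cot (Real.pi * x) : ℝ) : ℂ) := by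
      have hxc : (x : ℂ) ≠ 0 := by exact_mod_cast hx.ne'
      push_cast
      field_simp
      ring
    rw [this, Complex.ofReal_re]
  rw [e] at h
  refine h.congr fun n => ?_
  have : -(x : ℂ) * ∑ j ∈ Finset.range n, cotTerm x j =
      ((∑ j ∈ Finset.range n, 2 * x ^ 2 / (((j : ℝ) + 1) ^ 2 - x ^ 2) : ℝ) : ℂ) := by
    push_cast
    rw [Finset.mul_sum]
    refine Finset.sum_congr rfl fun j _ => ?_
    rw [cotTerm_identity hmem]
    have h1 : ((x : ℂ) + (j + 1)) * (x - (j + 1)) ≠ 0 := by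
      have h2 : ((x : ℂ) + (j + 1)) * (x - (j + 1)) =
          ((-(((j : ℝ) + 1) ^ 2 - x ^ 2) : ℝ) : ℂ) := by
        push_cast
        ring
      rw [h2]
      exact_mod_cast (neg_ne_zero.2 (hpos j).ne')
    have h3 : ((j : ℂ) + 1) ^ 2 - x ^ 2 = -(((x : ℂ) + (j + 1)) * (x - (j + 1))) := by ring
    rw [h3]
    field_simp
  simp only [Function.comp_apply, this, Complex.ofReal_re]

/-- The coefficient of `a ^ (2 m)` in the expansion of `z cot z`, `z = π a / 2`. -/
noncomputable def cotCoeff (m : ℕ) : ℝ :=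
  (-1) ^ m * ((bernoulli (2 * m) : ℝ) / ((2 * m).factorial : ℝ)) * Real.pi ^ (2 * m)

/-- The coefficient of `a ^ (2 k)` in the expansion of `tan z / z`, `z = π a / 2`. -/
noncomputable def tanCoeff (k : ℕ) : ℝ :=
  4 * (-1) ^ k * ((4 : ℝ) ^ (k + 1) - 1) *
    ((bernoulli (2 * k + 2) : ℝ) / ((2 * k + 2).factorial : ℝ)) * Real.pi ^ (2 * k)

/-- Each partial fraction of the cotangent is expanded as a geometric series. The double series is
nonnegative, so the order of summation may be exchanged, and the inner sums become the even zeta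
values. -/
theorem hasSum_cotCoeff {a : ℝ} (ha : 0 < a) (ha2 : a < 2) :
    HasSum (fun m => cotCoeff m * (a ^ 2) ^ m)
      (Real.pi * a / 2 * Real.cot (Real.pi * a / 2)) := by
  set x := a / 2 with hxdef
  have hx : 0 < x := by positivity
  have hx1 : x < 1 := by linarith
  let f : ℕ × ℕ → ℝ := fun p => 2 * (x ^ 2 / ((p.1 : ℝ) + 1) ^ 2) ^ (p.2 + 1)
  have hf0 : 0 ≤ f := fun p => by positivity
  have hrow : ∀ n : ℕ, HasSum (fun k => f (n, k)) (2 * x ^ 2 / (((n : ℝ) + 1) ^ 2 - x ^ 2)) := by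
    intro n
    have hpos := sq_sub_pos n (show x ^ 2 < 1 by nlinarith)
    have hm : 0 < ((n : ℝ) + 1) ^ 2 := by positivity
    have hr : x ^ 2 / ((n : ℝ) + 1) ^ 2 < 1 := by
      rw [div_lt_one hm]
      linarith
    have h := (hasSum_geometric_of_lt_one (by positivity) hr).mul_left
      (2 * (x ^ 2 / ((n : ℝ) + 1) ^ 2))
    have e : 2 * (x ^ 2 / ((n : ℝ) + 1) ^ 2) * (1 - x ^ 2 / ((n : ℝ) + 1) ^ 2)⁻¹ =
        2 * x ^ 2 / (((n : ℝ) + 1) ^ 2 - x ^ 2) := by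
      rw [one_sub_div hm.ne']
      field_simp
    rw [e] at h
    refine h.congr_fun ?_
    intro k
    simp only [f]
    ring
  have htot := hasSum_one_sub_pi_mul_cot hx hx1
  have hfs : Summable f := by
    rw [summable_prod_of_nonneg hf0]
    refine ⟨fun n => (hrow n).summable, ?_⟩
    simp only [fun n => (hrow n).tsum_eq]
    exact htot.summable
  have hfsum : HasSum f (1 - Real.pi * x * Real.cot (Real.pi * x)) := by
    have h := hfs.hasSum.prod_fiberwise hrow
    rw [← h.unique htot]
    exact hfs.hasSum
  have hcol : ∀ k : ℕ, HasSum (fun n => f (n, k)) (-(cotCoeff (k + 1) * (a ^ 2) ^ (k + 1))) := by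
    intro k
    have h := (hasSum_nat_add_iff' 1).2 (hasSum_zeta_nat (Nat.succ_ne_zero k))
    have h' := h.mul_left (2 * (x ^ 2) ^ (k + 1))
    convert! h' using 1
    · funext n
      simp only [f, div_pow, Nat.succ_eq_add_one]
      push_cast
      rw [← pow_mul (((n : ℝ) + 1)) 2]
      ring
    · simp only [cotCoeff, Finset.range_one, Finset.sum_singleton, Nat.succ_eq_add_one, hxdef]
      rw [show 2 * (k + 1) - 1 = 2 * k + 1 by omega]
      have h4 : ((a / 2) ^ 2) ^ (k + 1) = (a ^ 2) ^ (k + 1) / (2 * 2 ^ (2 * k + 1)) := by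
        rw [div_pow, div_pow, ← pow_mul, ← pow_mul]
        congr 1
        ring
      rw [h4]
      -- The zeta series starts at `n = 0`, where its term is `1 / 0 = 0`; dropping it changes
      -- nothing.
      have h5 : (((0 : ℕ) : ℝ)) ^ (2 * (k + 1)) = 0 := by simp
      rw [h5]
      field_simp
      ring
  have hswap : HasSum (fun p : ℕ × ℕ => f (p.2, p.1))
      (1 - Real.pi * x * Real.cot (Real.pi * x)) :=
    (Equiv.prodComm ℕ ℕ).hasSum_iff.2 hfsum
  have hk := (hswap.prod_fiberwise hcol).neg
  rw [← hasSum_nat_add_iff' 1]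
  simp only [neg_neg] at hk
  convert hk using 1
  simp only [Finset.range_one, Finset.sum_singleton, cotCoeff, hxdef]
  simp
  ring_nf

/-- This is `tan z = cot z - 2 cot 2z` with `z = πa/2`; the argument `2z` is why `a < 1` is needed.
-/
theorem hasSum_tanCoeff {a : ℝ} (ha : 0 < a) (ha1 : a < 1) :
    HasSum (fun k => tanCoeff k * (a ^ 2) ^ k)
      (Real.tan (Real.pi * a / 2) / (Real.pi * a / 2)) := by
  have hπ := Real.pi_pos
  have h := (hasSum_cotCoeff ha (by linarith)).sub
    (hasSum_cotCoeff (a := 2 * a) (by linarith) (by linarith))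
  -- The constant terms cancel, so the index can be shifted; the multiplier below is `1 / z²`.
  rw [← hasSum_nat_add_iff' 1] at h
  have h' := h.mul_left (4 / (Real.pi ^ 2 * a ^ 2))
  have hs : 0 < Real.sin (Real.pi * a / 2) :=
    Real.sin_pos_of_pos_of_lt_pi (by positivity) (by nlinarith)
  have hc : 0 < Real.cos (Real.pi * a / 2) :=
    Real.cos_pos_of_mem_Ioo ⟨by nlinarith, by nlinarith⟩
  convert! h' using 1
  · funext k
    simp only [tanCoeff, cotCoeff]
    rw [mul_pow 2 a, mul_pow, show ((2 : ℝ) ^ 2) = 4 by norm_num, show 2 * (k + 1) = 2 * k + 2 by ring]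
    field_simp
    ring
  · simp only [Finset.range_one, Finset.sum_singleton, pow_zero, mul_one, sub_self, sub_zero]
    rw [show Real.pi * (2 * a) / 2 = 2 * (Real.pi * a / 2) by ring, Real.cot_eq_cos_div_sin,
      Real.cot_eq_cos_div_sin, Real.tan_eq_sin_div_cos, Real.sin_two_mul, Real.cos_two_mul']
    field_simp
    ring

/-! ### Passage to the limit and convergence -/

theorem truncZetaStar_mono (l : List ℕ) : Monotone (truncZetaStar l) := by
  cases l with
  | nil => exact monotone_const
  | cons s l =>
    refine monotone_nat_of_le_succ fun N => ?_
    rw [truncZetaStar_cons_succ]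
    have := truncZetaStar_nonneg l (N + 1)
    exact le_add_of_nonneg_right (by positivity)

theorem gradedSum_mono {κ τ : ℝ} (hκ : κ ≤ 1) (hτ : 0 ≤ τ) {ε : ℕ → ℝ} (hε : ∀ m, 0 ≤ ε m)
    (w : ℕ) : Monotone fun N => gradedSum κ τ ε N w := by
  intro M N hMN
  refine Finset.sum_le_sum fun p _ => mul_le_mul_of_nonneg_left ?_
    (mul_nonneg (pow_nonneg hτ _) (hε _))
  exact wordSum_mono hκ _ _ fun l => truncZetaStar_mono l hMN

theorem truncSum_le_gradedSum {κ τ : ℝ} (hκ : κ ≤ 1) (hτ : 1 ≤ τ) (N d n : ℕ) :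
    truncSum κ N (2 * d) n ≤ gradedSum κ τ evenInd N (n + 2 * d) := by
  have h := Finset.single_le_sum (s := Finset.HasAntidiagonal.antidiagonal (n + 2 * d))
    (f := fun p : ℕ × ℕ => τ ^ p.1 * evenInd p.2 * truncSum κ N p.2 p.1)
    (fun p _ => mul_nonneg (mul_nonneg (by positivity) (evenInd_nonneg _))
      (truncSum_nonneg hκ _ _ _)) (a := (n, 2 * d)) (by simp)
  refine le_trans ?_ h
  have he : evenInd (2 * d) = 1 := by simp [evenInd]
  simp only [he, mul_one]
  exact le_mul_of_one_le_left (truncSum_nonneg hκ _ _ _) (one_le_pow₀ hτ)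

/-- The limit of the generating function of `truncSum`. -/
noncomputable def genLimit (κ τ lam : ℝ) : ℝ :=
  ((1 + (1 - κ) * τ) *
      ((Real.tan (Real.pi * √(lam * τ + lam) / 2) / (Real.pi * √(lam * τ + lam) / 2)) *
        (Real.pi * √(lam * τ - lam) / 2 * Real.cot (Real.pi * √(lam * τ - lam) / 2))) +
    (1 - (1 - κ) * τ) *
      ((Real.tan (Real.pi * √(lam * τ - lam) / 2) / (Real.pi * √(lam * τ - lam) / 2)) *
        (Real.pi * √(lam * τ + lam) / 2 * Real.cot (Real.pi * √(lam * τ + lam) / 2)))) / 2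

theorem exists_hasSum_gradedSum {κ τ lam : ℝ} (hκ0 : 0 ≤ κ) (hκ : κ ≤ 1) (hτ : 1 < τ)
    (hlam : 0 < lam) (hu : lam * τ + lam < 1) :
    ∃ p : ℕ → ℝ, Filter.Tendsto p Filter.atTop (nhds (genLimit κ τ lam)) ∧
      ∀ N, HasSum (fun w => gradedSum κ τ evenInd N w * lam ^ w) (p N) := by
  have hπ := Real.pi_pos
  have hv0 : 0 < lam * τ - lam := by nlinarith
  have hu0 : 0 < lam * τ + lam := by linarith
  have hv : lam * τ - lam < 1 := by linarith
  -- `P` and `Q` are the initial values `E 0 + y * C 0` and `E 0 - y * C 0`, where `C 0 = 1` and `E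
  -- 0 = -(1 - κ) * x`.
  set P := -(1 - κ) * (lam * τ) + lam with hP
  set Q := -(1 - κ) * (lam * τ) - lam with hQ
  have h0 : altDiff (lam * τ) lam P Q 0 = 1 := by
    simp only [altDiff, altProd, hP, hQ]
    field_simp
    ring
  have hE0 : altMean (lam * τ) lam P Q 0 = -(1 - κ) * (lam * τ) := by
    simp only [altMean, altProd, hP, hQ]
    ring
  have hsq : ∀ z : ℝ, 0 < z → z < 1 → 0 < √z ∧ √z < 1 := fun z h h' =>
    ⟨Real.sqrt_pos.2 h, by rw [Real.sqrt_lt' one_pos]; simpa using h'⟩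
  obtain ⟨ha, ha1⟩ := hsq _ hu0 hu
  obtain ⟨hb, hb1⟩ := hsq _ hv0 hv
  have hρ := tendsto_altProd ha ha1 hb hb1
  rw [Real.sq_sqrt hu0.le, Real.sq_sqrt hv0.le] at hρ
  have htrig : ∀ c : ℝ, 0 < c → c < 1 →
      0 < Real.sin (Real.pi * c / 2) ∧ 0 < Real.cos (Real.pi * c / 2) := fun c h h' =>
    ⟨Real.sin_pos_of_pos_of_lt_pi (by positivity) (by nlinarith),
      Real.cos_pos_of_mem_Ioo ⟨by nlinarith, by nlinarith⟩⟩
  obtain ⟨sa, ca⟩ := htrig _ ha ha1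
  obtain ⟨sb, cb⟩ := htrig _ hb hb1
  have hρ0 : Real.tan (Real.pi * √(lam * τ + lam) / 2) / (Real.pi * √(lam * τ + lam) / 2) *
        (Real.pi * √(lam * τ - lam) / 2 * Real.cot (Real.pi * √(lam * τ - lam) / 2)) ≠ 0 := by
    rw [Real.tan_eq_sin_div_cos, Real.cot_eq_cos_div_sin]
    positivity
  refine ⟨ratioSum (altDiff (lam * τ) lam P Q), ?_, fun N => ?_⟩
  · have h := tendsto_ratioSum (tendsto_altDiff (y := lam) P Q hρ0 hρ)
      (summable_abs_altDiff_sub P Q hlam (by nlinarith) hu hρ0 hρ)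
    convert! h using 2
    rw [genLimit, Real.tan_eq_sin_div_cos, Real.cot_eq_cos_div_sin, Real.tan_eq_sin_div_cos,
      Real.cot_eq_cos_div_sin, hP, hQ]
    set a := √(lam * τ + lam)
    set b := √(lam * τ - lam)
    field_simp
    ring
  · refine (hasSum_gradedSum hκ0 hκ (by linarith) hlam.le hu
      (q := ratioSumCompanion lam (altMean (lam * τ) lam P Q)) (by simp [ratioSum, h0])
      (by simp [ratioSumCompanion]) ?_ ?_ N).1
    · exact ratioSum_rec hlam.ne' h0 hE0 (altMean_sub P Q hlam hu)
    · exact ratioSumCompanion_rec hlam.ne' (altMean_add P Q hlam hu)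

/-- A single coefficient is bounded by the whole nonnegative generating function, which converges as
`N → ∞`. Any admissible `τ`, `λ` would do; here `λτ + λ = 3/4`. -/
theorem exists_truncSum_le (d n : ℕ) : ∃ c, ∀ N, truncSum 0 N (2 * d) n ≤ c := by
  obtain ⟨p, hp, hs⟩ := exists_hasSum_gradedSum (κ := 0) (τ := 2) (lam := 1 / 4) le_rfl
    zero_le_one (by norm_num) (by norm_num) (by norm_num)
  obtain ⟨K, hK⟩ := hp.bddAbove_range
  refine ⟨K * 4 ^ (n + 2 * d), fun N => ?_⟩
  refine (truncSum_le_gradedSum zero_le_one one_le_two N d n).trans ?_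
  have h1 := le_hasSum (hs N) (n + 2 * d) fun w _ => mul_nonneg
    (gradedSum_nonneg zero_le_one zero_le_two evenInd_nonneg N w) (by positivity)
  have h2 := h1.trans (hK ⟨N, rfl⟩)
  rw [one_div, inv_pow, ← div_eq_mul_inv, div_le_iff₀ (by positivity)] at h2
  exact h2

theorem summable_zetaStarTerm_word321 (d : ℕ) (a : Fin (2 * d) → ℕ) (b : ℕ) :
    Summable (zetaStarTerm (word321 d a ++ List.replicate b 2)) := by
  obtain ⟨c, hc⟩ := exists_truncSum_le d (∑ i, a i + b)
  refine summable_zetaStarTerm_of_bounded (c := c) fun N => ?_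
  exact (le_wordSum d b a (φ := fun l => truncZetaStar l N)
    fun l => truncZetaStar_nonneg l N).trans (hc N)

theorem tendsto_truncSum_zero (d n : ℕ) :
    Filter.Tendsto (fun N => truncSum 0 N (2 * d) n) Filter.atTop (nhds (ZStar d n)) := by
  simp only [truncSum, ← sum_word321_append, ZStar]
  exact tendsto_finsetSum _ fun a _ => tendsto_truncZetaStar (summable_zetaStarTerm_word321 d _ _)

theorem tendsto_truncSum_one (d n : ℕ) :
    Filter.Tendsto (fun N => truncSum 1 N (2 * d) n) Filter.atTop (nhds (ZStar₀ d n)) := by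
  simp only [truncSum, ← sum_word321, ZStar₀]
  refine tendsto_finsetSum _ fun a _ => tendsto_truncZetaStar ?_
  have h := summable_zetaStarTerm_word321 d a 0
  rwa [List.replicate_zero, List.append_nil] at h

/-- Monotone convergence for series: finite partial sums pass to the limit for one inequality, and
termwise domination `f N ≤ g` gives the other. -/
theorem hasSum_of_monotone_tendsto {f : ℕ → ℕ → ℝ} {g p : ℕ → ℝ} {L : ℝ}
    (h0 : ∀ N w, 0 ≤ f N w) (hm : ∀ w, Monotone fun N => f N w)
    (hg : ∀ w, Filter.Tendsto (fun N => f N w) Filter.atTop (nhds (g w)))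
    (hf : ∀ N, HasSum (f N) (p N)) (hp : Filter.Tendsto p Filter.atTop (nhds L)) :
    HasSum g L := by
  have hfg : ∀ N w, f N w ≤ g w := fun N w => (hm w).ge_of_tendsto (hg w) N
  have hg0 : ∀ w, 0 ≤ g w := fun w => (h0 0 w).trans (hfg 0 w)
  have hle : ∀ W, ∑ w ∈ Finset.range W, g w ≤ L := fun W =>
    le_of_tendsto_of_tendsto' (tendsto_finsetSum _ fun w _ => hg w) hp fun N =>
      sum_le_hasSum _ (fun w _ => h0 N w) (hf N)
  have hs : Summable g := summable_of_sum_range_le hg0 hle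
  have h1 : ∑' w, g w ≤ L := hs.tsum_le_of_sum_range_le hle
  have h2 : L ≤ ∑' w, g w := le_of_tendsto' hp fun N => hasSum_le (hfg N) (hf N) hs.hasSum
  rw [← le_antisymm h1 h2]
  exact hs.hasSum

theorem hasSum_genLimit_left {κ τ lam : ℝ} (hκ0 : 0 ≤ κ) (hκ : κ ≤ 1) (hτ : 1 < τ)
    (hlam : 0 < lam) (hu : lam * τ + lam < 1) {Z : ℕ → ℕ → ℝ}
    (hZ : ∀ d n, Filter.Tendsto (fun N => truncSum κ N (2 * d) n) Filter.atTop (nhds (Z d n))) :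
    HasSum (fun w => (∑ p ∈ Finset.HasAntidiagonal.antidiagonal w,
      τ ^ p.1 * evenInd p.2 * Z (p.2 / 2) p.1) * lam ^ w) (genLimit κ τ lam) := by
  obtain ⟨p, hp, hs⟩ := exists_hasSum_gradedSum hκ0 hκ hτ hlam hu
  have hτ0 : 0 ≤ τ := by linarith
  refine hasSum_of_monotone_tendsto (f := fun N w => gradedSum κ τ evenInd N w * lam ^ w)
    (fun N w => mul_nonneg (gradedSum_nonneg hκ hτ0 evenInd_nonneg N w) (by positivity))
    (fun w M N hMN => mul_le_mul_of_nonneg_right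
      (gradedSum_mono hκ hτ0 evenInd_nonneg w hMN) (by positivity))
    (fun w => ?_) hs hp
  refine Filter.Tendsto.mul_const _ (tendsto_finsetSum _ fun q _ => ?_)
  by_cases hq : Even q.2
  · obtain ⟨d, hd⟩ := even_iff_exists_two_mul.1 hq
    rw [hd, Nat.mul_div_cancel_left d two_pos]
    exact (hZ d q.1).const_mul _
  · simp [evenInd, hq]

/-! ### Comparison of coefficients in `λ` -/

theorem hasSum_tanCoeff_mul_cotCoeff {u v : ℝ} (hu : 0 < u) (hu1 : u < 1) (hv : 0 < v)
    (hv1 : v < 1) :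
    HasSum (fun w => ∑ p ∈ Finset.HasAntidiagonal.antidiagonal w,
        tanCoeff p.1 * u ^ p.1 * (cotCoeff p.2 * v ^ p.2))
      ((Real.tan (Real.pi * √u / 2) / (Real.pi * √u / 2)) *
        (Real.pi * √v / 2 * Real.cot (Real.pi * √v / 2))) := by
  have hsq : ∀ z : ℝ, 0 < z → z < 1 → 0 < √z ∧ √z < 1 := fun z h h' =>
    ⟨Real.sqrt_pos.2 h, by rw [Real.sqrt_lt' one_pos]; simpa using h'⟩
  have h1 := hasSum_tanCoeff (hsq u hu hu1).1 (hsq u hu hu1).2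
  have h2 := hasSum_cotCoeff (hsq v hv hv1).1 ((hsq v hv hv1).2.trans one_lt_two)
  rw [Real.sq_sqrt hu.le] at h1
  rw [Real.sq_sqrt hv.le] at h2
  rw [← h1.tsum_eq, ← h2.tsum_eq,
    tsum_mul_tsum_eq_tsum_sum_antidiagonal_of_summable_norm h1.summable.norm h2.summable.norm]
  exact (summable_norm_sum_mul_antidiagonal_of_summable_norm h1.summable.norm
    h2.summable.norm).of_norm.hasSum

theorem hasSum_genLimit_right {κ τ lam : ℝ} (hτ : 1 < τ)
    (hlam : 0 < lam) (hu : lam * τ + lam < 1) :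
    HasSum (fun w => (∑ p ∈ Finset.HasAntidiagonal.antidiagonal w, tanCoeff p.1 * cotCoeff p.2 *
      ((1 + (1 - κ) * τ) * ((τ + 1) ^ p.1 * (τ - 1) ^ p.2) +
        (1 - (1 - κ) * τ) * ((τ - 1) ^ p.1 * (τ + 1) ^ p.2)) / 2) * lam ^ w)
      (genLimit κ τ lam) := by
  have hv0 : 0 < lam * τ - lam := by nlinarith
  have hu0 : 0 < lam * τ + lam := by linarith
  have hv : lam * τ - lam < 1 := by linarith
  have h := (((hasSum_tanCoeff_mul_cotCoeff hu0 hu hv0 hv).mul_left (1 + (1 - κ) * τ)).add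
    ((hasSum_tanCoeff_mul_cotCoeff hv0 hv hu0 hu).mul_left (1 - (1 - κ) * τ))).div_const 2
  rw [genLimit]
  convert! h using 1
  funext w
  rw [Finset.mul_sum, Finset.mul_sum, ← Finset.sum_add_distrib, Finset.sum_div, Finset.sum_mul]
  refine Finset.sum_congr rfl fun p hp => ?_
  rw [Finset.HasAntidiagonal.mem_antidiagonal] at hp
  rw [← hp, pow_add, show lam * τ + lam = lam * (τ + 1) by ring,
    show lam * τ - lam = lam * (τ - 1) by ring]
  simp only [mul_pow]
  ring

/-- The expansions are known only for positive `z`, so the constant term is isolated by a one-sided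
limit: the rest of the series is at most a constant times `z`. -/
theorem coeff_zero_eq_zero_of_hasSum_zero {d : ℕ → ℝ} {ε : ℝ} (hε : 0 < ε)
    (h : ∀ z, 0 < z → z < ε → HasSum (fun w => d w * z ^ w) 0) : d 0 = 0 := by
  have hz : 0 < ε / 2 := by positivity
  have hs := ((summable_nat_add_iff 1).2 (h (ε / 2) hz (by linarith)).summable).abs
  set K := ∑' w, |d (w + 1) * (ε / 2) ^ (w + 1)| with hK
  have hbound : ∀ z, 0 < z → z ≤ ε / 2 → |d 0| ≤ z * (K / (ε / 2)) := by
    intro z hz0 hz1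
    have h1 := (hasSum_nat_add_iff' 1).2 (h z hz0 (by linarith))
    simp only [Finset.range_one, Finset.sum_singleton, pow_zero, mul_one, zero_sub] at h1
    rw [← abs_neg, ← h1.tsum_eq, hK, ← tsum_div_const, ← tsum_mul_left]
    have hle : ∀ w, |d (w + 1) * z ^ (w + 1)| ≤
        z * (|d (w + 1) * (ε / 2) ^ (w + 1)| / (ε / 2)) := by
      intro w
      rw [abs_mul, abs_mul, abs_of_pos (pow_pos hz0 _), abs_of_pos (pow_pos hz _)]
      have h2 : z ^ w ≤ (ε / 2) ^ w := pow_le_pow_left₀ hz0.le hz1 w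
      have h3 : z * (|d (w + 1)| * (ε / 2) ^ (w + 1) / (ε / 2)) =
          |d (w + 1)| * (z * (ε / 2) ^ w) := by
        rw [pow_succ]
        field_simp
      rw [h3, pow_succ, mul_comm (z ^ w)]
      gcongr
    have hs' : Summable fun w => z * (|d (w + 1) * (ε / 2) ^ (w + 1)| / (ε / 2)) :=
      (hs.div_const _).mul_left _
    calc |∑' w, d (w + 1) * z ^ (w + 1)| ≤ ∑' w, |d (w + 1) * z ^ (w + 1)| := by
          simpa only [Real.norm_eq_abs] using norm_tsum_le_tsum_norm h1.summable.norm
      _ ≤ _ := h1.summable.abs.tsum_le_tsum hle hs'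
  have hlim : Filter.Tendsto (fun z : ℝ => z * (K / (ε / 2))) (nhdsWithin 0 (Set.Ioi 0))
      (nhds 0) := by
    have : Filter.Tendsto (fun z : ℝ => z * (K / (ε / 2))) (nhds 0) (nhds (0 * (K / (ε / 2)))) :=
      Filter.tendsto_id.mul_const _
    rw [zero_mul] at this
    exact this.mono_left nhdsWithin_le_nhds
  have hev : ∀ᶠ z in nhdsWithin (0 : ℝ) (Set.Ioi 0), |d 0| ≤ z * (K / (ε / 2)) := by
    filter_upwards [Ioc_mem_nhdsGT hz] with z hz'
    exact hbound z hz'.1 hz'.2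
  exact abs_nonpos_iff.1 (ge_of_tendsto hlim hev)

theorem eq_zero_of_hasSum_zero {d : ℕ → ℝ} {ε : ℝ} (hε : 0 < ε)
    (h : ∀ z, 0 < z → z < ε → HasSum (fun w => d w * z ^ w) 0) (n : ℕ) : d n = 0 := by
  induction n generalizing d with
  | zero => exact coeff_zero_eq_zero_of_hasSum_zero hε h
  | succ n ih =>
    have h0 : d 0 = 0 := coeff_zero_eq_zero_of_hasSum_zero hε h
    refine ih (d := fun w => d (w + 1)) fun z hz0 hz1 => ?_
    have h1 := (hasSum_nat_add_iff' 1).2 (h z hz0 hz1)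
    simp only [Finset.range_one, Finset.sum_singleton, pow_zero, mul_one, h0, sub_self] at h1
    have h2 := h1.mul_left z⁻¹
    rw [mul_zero] at h2
    refine h2.congr_fun fun w => ?_
    rw [pow_succ]
    field_simp

/-! ### Comparison of coefficients in `τ` -/

open Polynomial in
theorem coeff_X_sub_one_pow (m j : ℕ) :
    ((X - C (1 : ℝ)) ^ m).coeff j = (-1) ^ (m - j) * (m.choose j : ℝ) := by
  rw [sub_eq_add_neg, ← C_neg, coeff_X_add_C_pow]

open Polynomial in
theorem coeff_X_add_one_pow_mul_X_sub_one_pow (k m n : ℕ) :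
    ((X + C (1 : ℝ)) ^ k * (X - C (1 : ℝ)) ^ m).coeff n =
      ∑ r ∈ Finset.range (n + 1),
        (-1 : ℝ) ^ (m + n + r) * (k.choose r : ℝ) * (m.choose (n - r) : ℝ) := by
  rw [coeff_mul, Finset.Nat.sum_antidiagonal_eq_sum_range_succ_mk]
  refine Finset.sum_congr rfl fun r hr => ?_
  have hrn : r ≤ n := Nat.lt_succ_iff.1 (Finset.mem_range.1 hr)
  rw [coeff_X_add_C_pow, coeff_X_sub_one_pow, one_pow, one_mul]
  rcases le_or_gt (n - r) m with h | h
  · have e : (-1 : ℝ) ^ (m - (n - r)) = (-1) ^ (m + n + r) := by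
      rw [show m + n + r = m - (n - r) + 2 * n by omega, pow_add, pow_mul]
      simp
    rw [e]
    ring
  · rw [Nat.choose_eq_zero_of_lt h]
    simp

-- The substitution `X ↦ -X` exchanges the two products up to the sign `(-1) ^ (k + m)`.
open Polynomial in
theorem coeff_X_sub_one_pow_mul_X_add_one_pow (k m n e : ℕ) (h : k + m = n + e) :
    ((X - C (1 : ℝ)) ^ k * (X + C (1 : ℝ)) ^ m).coeff n =
      (-1) ^ e * ((X + C (1 : ℝ)) ^ k * (X - C (1 : ℝ)) ^ m).coeff n := by
  rw [coeff_mul, coeff_mul, Finset.mul_sum]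
  refine Finset.sum_congr rfl fun p hp => ?_
  rw [Finset.HasAntidiagonal.mem_antidiagonal] at hp
  simp only [coeff_X_add_C_pow, coeff_X_sub_one_pow, one_pow, one_mul]
  rcases le_or_gt p.1 k with h1 | h1
  · rcases le_or_gt p.2 m with h2 | h2
    · have e : (-1 : ℝ) ^ (k - p.1) = (-1) ^ e * (-1) ^ (m - p.2) := by
        rw [← pow_add, show e + (m - p.2) = (k - p.1) + 2 * (m - p.2) by omega, pow_add _ (k - p.1),
          pow_mul]
        simp
      rw [e]
      ring
    · simp [Nat.choose_eq_zero_of_lt h2]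
  · simp [Nat.choose_eq_zero_of_lt h1]

theorem antidiagonal_sum_eq {κ τ : ℝ} (hκ0 : 0 ≤ κ) (hκ : κ ≤ 1) (hτ : 1 < τ) {Z : ℕ → ℕ → ℝ}
    (hZ : ∀ d n, Filter.Tendsto (fun N => truncSum κ N (2 * d) n) Filter.atTop (nhds (Z d n)))
    (w : ℕ) :
    ∑ p ∈ Finset.HasAntidiagonal.antidiagonal w, τ ^ p.1 * evenInd p.2 * Z (p.2 / 2) p.1 =
      ∑ p ∈ Finset.HasAntidiagonal.antidiagonal w, tanCoeff p.1 * cotCoeff p.2 *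
        ((1 + (1 - κ) * τ) * ((τ + 1) ^ p.1 * (τ - 1) ^ p.2) +
          (1 - (1 - κ) * τ) * ((τ - 1) ^ p.1 * (τ + 1) ^ p.2)) / 2 := by
  -- For `z < 1 / (τ + 1)` the condition `zτ + z < 1` holds.
  have hε : 0 < 1 / (τ + 1) := by positivity
  refine sub_eq_zero.1 (eq_zero_of_hasSum_zero (d := fun w =>
    (∑ p ∈ Finset.HasAntidiagonal.antidiagonal w, τ ^ p.1 * evenInd p.2 * Z (p.2 / 2) p.1) -
      ∑ p ∈ Finset.HasAntidiagonal.antidiagonal w, tanCoeff p.1 * cotCoeff p.2 *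
        ((1 + (1 - κ) * τ) * ((τ + 1) ^ p.1 * (τ - 1) ^ p.2) +
          (1 - (1 - κ) * τ) * ((τ - 1) ^ p.1 * (τ + 1) ^ p.2)) / 2) hε (fun z hz0 hz1 => ?_) w)
  have hu : z * τ + z < 1 := by
    rw [lt_div_iff₀ (by linarith)] at hz1
    linarith
  have h := (hasSum_genLimit_left hκ0 hκ hτ hz0 hu hZ).sub (hasSum_genLimit_right (κ := κ) hτ hz0 hu)
  rw [sub_self] at h
  refine h.congr_fun fun w => ?_
  ring

open Polynomial in
/-- The coefficient comparison; `δ = 0` for the words that end in `1`, `δ = 1` for all words. -/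
theorem limit_eq_sum_coeff (δ : ℕ) (hδ : δ = 0 ∨ δ = 1) {Z : ℕ → ℕ → ℝ}
    (hZ : ∀ d n, Filter.Tendsto (fun N => truncSum (1 - δ) N (2 * d) n) Filter.atTop
      (nhds (Z d n))) (d n : ℕ) :
    Z d n = ∑ p ∈ Finset.HasAntidiagonal.antidiagonal (n + 2 * d),
      tanCoeff p.1 * cotCoeff p.2 *
        ((X + C (1 : ℝ)) ^ (p.1 + δ) * (X - C (1 : ℝ)) ^ p.2).coeff n := by
  have hpoly : ∑ p ∈ Finset.HasAntidiagonal.antidiagonal (n + 2 * d),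
      C (evenInd p.2 * Z (p.2 / 2) p.1) * X ^ p.1 =
      ∑ p ∈ Finset.HasAntidiagonal.antidiagonal (n + 2 * d), C (tanCoeff p.1 * cotCoeff p.2 / 2) *
        ((X + C (1 : ℝ)) ^ (p.1 + δ) * (X - C (1 : ℝ)) ^ p.2 +
          C ((-1) ^ δ) * ((X - C (1 : ℝ)) ^ (p.1 + δ) * (X + C (1 : ℝ)) ^ p.2)) := by
    -- Both sides are polynomials in `τ` that agree for all `τ > 1`.
    refine Polynomial.eq_of_infinite_eval_eq _ _ ((Set.Ioi_infinite (1 : ℝ)).mono fun τ hτ => ?_)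
    have h := antidiagonal_sum_eq (κ := 1 - δ) (by rcases hδ with rfl | rfl <;> norm_num)
      (by rcases hδ with rfl | rfl <;> norm_num) hτ hZ (n + 2 * d)
    simp only [Set.mem_ofPred_eq, eval_finsetSum, eval_mul, eval_add, eval_pow, eval_X, eval_C,
      eval_sub]
    refine Eq.trans (Finset.sum_congr rfl fun p _ => ?_)
      (h.trans (Finset.sum_congr rfl fun p _ => ?_))
    · ring
    · rcases hδ with rfl | rfl
      · push_cast
        ring
      · push_cast
        ring
  have hc := congrArg (fun f => coeff f n) hpoly
  simp only [finsetSum_coeff, coeff_C_mul, coeff_X_pow, coeff_add] at hc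
  rw [Finset.sum_eq_single (n, 2 * d)] at hc
  · have he : evenInd (2 * d) = 1 := by simp [evenInd]
    simp only [he, one_mul, if_true, mul_one, Nat.mul_div_cancel_left d two_pos] at hc
    rw [hc]
    refine Finset.sum_congr rfl fun p hp => ?_
    rw [Finset.HasAntidiagonal.mem_antidiagonal] at hp
    -- The two signs `(-1) ^ δ` and `(-1) ^ (2d + δ)` multiply to 1, so both products contribute
    -- equally and cancel the factor 1/2.
    rw [coeff_X_sub_one_pow_mul_X_add_one_pow (p.1 + δ) p.2 n (2 * d + δ) (by omega), ← mul_assoc,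
      ← pow_add, show δ + (2 * d + δ) = 2 * (d + δ) by ring, pow_mul]
    norm_num
    ring
  · rintro ⟨i, j⟩ hp hne
    rw [Finset.HasAntidiagonal.mem_antidiagonal] at hp
    have : n ≠ i := by
      rintro rfl
      exact hne (by simp only [Prod.mk.injEq, true_and]; simpa using hp)
    simp [this]
  · simp

/-! ### The Bernoulli sums -/

theorem limit_eq_bernoulli_sum (δ : ℕ) (hδ : δ = 0 ∨ δ = 1) {Z : ℕ → ℕ → ℝ}
    (hZ : ∀ d n, Filter.Tendsto (fun N => truncSum (1 - δ) N (2 * d) n) Filter.atTop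
      (nhds (Z d n))) (d n : ℕ) :
    Z d n = 4 * Real.pi ^ (2 * n + 4 * d) *
      ∑ k ∈ Finset.range (n + 2 * d + 1), ∑ r ∈ Finset.range (n + 1),
        (-1 : ℝ) ^ (n + k + r) * ((4 : ℝ) ^ (k + 1) - 1) *
          ((k + δ).choose r : ℝ) * ((n + 2 * d - k).choose (n - r) : ℝ) *
          ((bernoulli (2 * k + 2) : ℝ) / ((2 * k + 2).factorial : ℝ)) *
          ((bernoulli (2 * n + 4 * d - 2 * k) : ℝ) /
            ((2 * n + 4 * d - 2 * k).factorial : ℝ)) := by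
  rw [limit_eq_sum_coeff δ hδ hZ, Finset.Nat.sum_antidiagonal_eq_sum_range_succ_mk, Finset.mul_sum]
  refine Finset.sum_congr rfl fun k hk => ?_
  rw [coeff_X_add_one_pow_mul_X_sub_one_pow, Finset.mul_sum, Finset.mul_sum]
  refine Finset.sum_congr rfl fun r _ => ?_
  obtain ⟨m, hm⟩ := Nat.exists_eq_add_of_le (Nat.lt_succ_iff.1 (Finset.mem_range.1 hk))
  rw [show 2 * n + 4 * d - 2 * k = 2 * m by omega, show n + 2 * d - k = m by omega,
    show 2 * n + 4 * d = 2 * k + 2 * m by omega]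
  have hsign : (-1 : ℝ) ^ k * (-1) ^ m * (-1) ^ (m + n + r) = (-1) ^ (n + k + r) := by
    rw [← pow_add, ← pow_add, show k + m + (m + n + r) = n + k + r + 2 * m by ring,
      pow_add _ (n + k + r), pow_mul]
    simp
  simp only [tanCoeff, cotCoeff, pow_add Real.pi, ← hsign]
  ring

theorem theorem2 (d n : ℕ) (hd : 1 ≤ d) :
    -- all the series that occur in the three sums converge
    (∀ (a : Fin (2 * d) → ℕ) (b : ℕ),
      Summable (zetaStarTerm (word321 d a ++ List.replicate b 2))) ∧
    ZStar₀ d n = 4 * Real.pi ^ (2 * n + 4 * d) *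
      ∑ k ∈ Finset.range (n + 2 * d + 1), ∑ r ∈ Finset.range (n + 1),
        (-1 : ℝ) ^ (n + k + r) * ((4 : ℝ) ^ (k + 1) - 1) *
          (k.choose r : ℝ) * ((n + 2 * d - k).choose (n - r) : ℝ) *
          ((bernoulli (2 * k + 2) : ℝ) / ((2 * k + 2).factorial : ℝ)) *
          ((bernoulli (2 * n + 4 * d - 2 * k) : ℝ) /
            ((2 * n + 4 * d - 2 * k).factorial : ℝ)) ∧
    ZStar d n = 4 * Real.pi ^ (2 * n + 4 * d) *
      ∑ k ∈ Finset.range (n + 2 * d + 1), ∑ r ∈ Finset.range (n + 1),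
        (-1 : ℝ) ^ (n + k + r) * ((4 : ℝ) ^ (k + 1) - 1) *
          ((k + 1).choose r : ℝ) * ((n + 2 * d - k).choose (n - r) : ℝ) *
          ((bernoulli (2 * k + 2) : ℝ) / ((2 * k + 2).factorial : ℝ)) *
          ((bernoulli (2 * n + 4 * d - 2 * k) : ℝ) /
            ((2 * n + 4 * d - 2 * k).factorial : ℝ)) ∧
    (1 ≤ n → ZStar₁ d n = 4 * Real.pi ^ (2 * n + 4 * d) *
      ∑ k ∈ Finset.range (n + 2 * d + 1), ∑ r ∈ Finset.range n,
        (-1 : ℝ) ^ (n + k + r + 1) * ((4 : ℝ) ^ (k + 1) - 1) *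
          (k.choose r : ℝ) * ((n + 2 * d - k).choose (n - 1 - r) : ℝ) *
          ((bernoulli (2 * k + 2) : ℝ) / ((2 * k + 2).factorial : ℝ)) *
          ((bernoulli (2 * n + 4 * d - 2 * k) : ℝ) /
            ((2 * n + 4 * d - 2 * k).factorial : ℝ))) := by
  have h0 := limit_eq_bernoulli_sum 0 (Or.inl rfl) (Z := ZStar₀)
    (by simpa using tendsto_truncSum_one) d n
  have h1 := limit_eq_bernoulli_sum 1 (Or.inr rfl) (Z := ZStar)
    (by simpa using tendsto_truncSum_zero) d n
  refine ⟨summable_zetaStarTerm_word321 d, h0, h1, fun _ => ?_⟩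
  -- `Z⋆₁ = Z⋆ - Z⋆₀`: the terms with `r = 0` cancel, Pascal's rule handles the others, and the
  -- shift of `r` by one produces the extra sign.
  rw [← sub_eq_iff_eq_add'.2 (ZStar_eq_add d n), h1, h0, ← mul_sub, ← Finset.sum_sub_distrib]
  congr 1
  refine Finset.sum_congr rfl fun k _ => ?_
  rw [Finset.sum_range_succ', Finset.sum_range_succ', add_sub_add_comm, ← Finset.sum_sub_distrib]
  simp only [Nat.choose_zero_right, sub_self, add_zero]
  refine Finset.sum_congr rfl fun r _ => ?_
  rw [Nat.choose_succ_succ, show n - 1 - r = n - (r + 1) by omega]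
  push_cast
  ring
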